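/- Let $n\ge 1$ be an integer and $\alpha,\beta>0$. For $t\ge 0$ let $w(x;t)=x^{\alpha}(1-x)^{\beta}e^{-t/x}$ on $(0,1)$, let $D_n(t)=\det\big(\int_0^1 x^{j+k}w(x;t)\,dx\big)_{j,k=0}^{n-1}$ (which is positive), let $P_m(x;t)$ be the monic polynomial of degree $m$ orthogonal to all polynomials of lower degree with respect to $w(\cdot;t)$, and let $h_m(t)=\int_0^1P_m(x;t)^2w(x;t)\,dx$. Put $$R_n(t)=\frac{\beta}{h_n(t)}\int_0^1\frac{P_n(x;t)^2w(x;t)}{1-x}\,dx,\qquad r_n^{*}(t)=\frac{t}{h_{n-1}(t)}\int_0^1\frac{P_n(x;t)P_{n-1}(x;t)w(x;t)}{x}\,dx,$$ $$y(t)=\frac{R_n(t)}{2n+1+\alpha+\beta},\qquad H_n(t)=t\frac{d}{dt}\ln\frac{D_n(t)}{D_n(0)}.$$ Then the following hold. 1. $y$ is a $\mathrm{P_V}\big((2n+1+\alpha+\beta)^2/2,-\beta^2/2,\alpha,-1/2\big)$ transcendent: for all $t>0$, $y(t)\notin\{0,1\}$, $y$ is twice differentiable at $t$, and $$y''=\frac{3y-1}{2y(y-1)}(y')^2-\frac{y'}{t}+\frac{(2n+1+\alpha+\beta)^2(y-1)^2y}{2t^2}-\frac{(y-1)^2\beta^2}{2t^2y}+\frac{\alpha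 y}{t}-\frac{y(y+1)}{2(y-1)};$$ moreover $y(0)=1$ and $y(t)\to1$ as $t\to0^+$. 2. $D_n$ is differentiable on $(0,\infty)$ and, for all $t>0$, $$\begin{aligned}H_n(t)={}&-\frac{1}{4y(y-1)^2}\Big[\beta^2+2y^3-2(2n+\alpha+\beta)^2y^3-2(t+\beta)(2n+\alpha+\beta)y^3-y^4-t^2y'^2+(2n+\alpha+\beta)^2y^4\\&-4n(t+\beta)y-2\beta(t+\alpha+2\beta)y-2ty'y+2ty'y^2+4n^2y^2\\&+y^2\big((t+\alpha)^2+4t\beta+6\alpha\beta+6\beta^2-1\big)+4n(2t+\alpha+3\beta)y^2\Big]+n(n+\alpha-t),\end{aligned}$$ with the initial data $H_n(0)=0$, where also $H_n(t)\to0$ as $t\to0^+$. 3. $r_n^*$ is likewise expressed through $y$, $y'$, $t$ and $n$: writing $F(t)$ for the right-hand side of the formula in 2, for all $t>0$, $$r_n^*(t)=\frac{(1-y)\,\big(F(t)-n(n+\alpha-t)\big)}{2n+\alpha+\beta}+\frac12\Big[ty'+(1-y)\big((2n+1+\alpha+\beta)y-\beta\big)+ty\Big].$$ 4. The Hankel determinant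 has an integral representation in terms of this $\mathrm{P_V}$ transcendent: for all $t>0$ the function $s\mapsto F(s)/s$ is integrable on $(0,t)$, and $$D_n(t)=D_n(0)\exp\Big(\int_0^t\frac{F(s)}{s}\,ds\Big).$$ -/

import Mathlib

open Filter Topology

namespace PollaczekJacobi

noncomputable section

/-- The Pollaczek-Jacobi type weight `x ^ α (1 - x) ^ β e ^ (-t / x)` (used for `0 < x < 1`). -/
def weight (α β t x : ℝ) : ℝ :=
  x ^ α * (1 - x) ^ β * Real.exp (-t / x)

/-- The bilinear form `(p, q) ↦ ∫₀¹ p(x) q(x) w(x; t, α, β) dx` on polynomials. -/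
def ip (α β t : ℝ) (p q : Polynomial ℝ) : ℝ :=
  ∫ x in (0 : ℝ)..1, p.eval x * q.eval x * weight α β t x

/-- The Hankel determinant `D_n(t, α, β)` of the moments of the weight. -/
def hankelDet (n : ℕ) (α β t : ℝ) : ℝ :=
  Matrix.det (Matrix.of fun j k : Fin n =>
    ∫ x in (0 : ℝ)..1, x ^ ((j : ℕ) + (k : ℕ)) * weight α β t x)

/-- The monic orthogonal polynomial `P_n(x; t, α, β)` of degree `n` for the weight, obtained from
the monomials by Gram-Schmidt orthogonalization without normalization. -/
def orthoPoly (α β t : ℝ) : ℕ → Polynomial ℝ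
  | n => Polynomial.X ^ n - ∑ j : Fin n,
      Polynomial.C (ip α β t (Polynomial.X ^ n) (orthoPoly α β t j) /
        ip α β t (orthoPoly α β t j) (orthoPoly α β t j)) * orthoPoly α β t j
  termination_by n => n
  decreasing_by all_goals exact j.isLt

/-- The squared norm `h_n = ∫₀¹ P_n(x)² w(x) dx`. -/
def normSq (n : ℕ) (α β t : ℝ) : ℝ :=
  ip α β t (orthoPoly α β t n) (orthoPoly α β t n)

/-- `R_n(t) = (β / h_n) ∫₀¹ P_n(x)² w(x) / (1 - x) dx`. -/
def RFun (n : ℕ) (α β t : ℝ) : ℝ :=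
  β / normSq n α β t *
    ∫ x in (0 : ℝ)..1, (orthoPoly α β t n).eval x ^ 2 * weight α β t x / (1 - x)

/-- `r_n^*(t) = (t / h_{n-1}) ∫₀¹ P_n(x) P_{n-1}(x) w(x) / x dx`, for `n ≥ 1`. -/
def rStar (n : ℕ) (α β t : ℝ) : ℝ :=
  t / normSq (n - 1) α β t *
    ∫ x in (0 : ℝ)..1, (orthoPoly α β t n).eval x * (orthoPoly α β t (n - 1)).eval x *
      weight α β t x / x

/-- `y(t, α, β) = R_n(t) / (2n + 1 + α + β)`. -/
def yFun (n : ℕ) (α β t : ℝ) : ℝ :=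
  RFun n α β t / (2 * n + 1 + α + β)

/-- `H_n(t, α, β) = t d/dt ln (D_n(t, α, β) / D_n(0, α, β))`. -/
def HFun (n : ℕ) (α β t : ℝ) : ℝ :=
  t * deriv (fun s => Real.log (hankelDet n α β s / hankelDet n α β 0)) t

/-- The right-hand side of the expression of `H_n` through `y` and its derivative, as a rational
function of `t`, of the value `u` of `y` and of the value `v` of the derivative of `y`. -/
def HExpr (n : ℕ) (α β t u v : ℝ) : ℝ :=
  -(1 / (4 * u * (u - 1) ^ 2)) *
    (β ^ 2 + 2 * u ^ 3 - 2 * (2 * n + α + β) ^ 2 * u ^ 3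
      - 2 * (t + β) * (2 * n + α + β) * u ^ 3 - u ^ 4 - t ^ 2 * v ^ 2
      + (2 * n + α + β) ^ 2 * u ^ 4 - 4 * n * (t + β) * u - 2 * β * (t + α + 2 * β) * u
      - 2 * t * v * u + 2 * t * v * u ^ 2 + 4 * n ^ 2 * u ^ 2
      + u ^ 2 * ((t + α) ^ 2 + 4 * t * β + 6 * α * β + 6 * β ^ 2 - 1)
      + 4 * n * (2 * t + α + 3 * β) * u ^ 2)
    + n * (n + α - t)

/-- The expression of `r_n^*` as a rational function of `t`, of the value `u` of `y` and of the
value `v` of the derivative of `y`. -/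
def rStarExpr (n : ℕ) (α β t u v : ℝ) : ℝ :=
  (1 - u) * (HExpr n α β t u v - n * (n + α - t)) / (2 * n + α + β)
    + (t * v + (1 - u) * ((2 * n + 1 + α + β) * u - β) + t * u) / 2

/-- The function `f` solves, at every `t > 0`, the fifth Painlevé equation `P_V(a, b, c, d)`;
that `f` avoids the singular values `0` and `1` and is twice differentiable is part of this. -/
def SolvesPV (a b c d : ℝ) (f : ℝ → ℝ) : Prop :=
  ∀ t : ℝ, 0 < t →
    f t ≠ 0 ∧ f t ≠ 1 ∧ DifferentiableAt ℝ f t ∧ DifferentiableAt ℝ (deriv f) t ∧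
    deriv (deriv f) t =
      (1 / (2 * f t) + 1 / (f t - 1)) * deriv f t ^ 2 - deriv f t / t
        + (f t - 1) ^ 2 / t ^ 2 * (a * f t + b / f t)
        + c * f t / t + d * f t * (f t + 1) / (f t - 1)

end

end PollaczekJacobi

open PollaczekJacobi

/-
The logarithmic derivative of the weight, `α / x + β / (x - 1) + t / x ^ 2`, is rational, so
integrating the Pearson equation by parts against products of `P_n` and `P_{n-1}` yields algebraic
relations between `R_n`, `r_n`, `r*_n`, the subleading coefficient `p_n` of `P_n` and
`S_n = R_n - (2n + 1 + α + β)`. The quadratic ones, which also involve `h_n / h_{n-1}`, express that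
at an endpoint `a` the kernel `∫ P_m P_n w / (x - a)` factors through `P_m(a)` and
`∫ P_n w / (x - a)`, up to a multiple of `h_{n-1}`.

Differentiating the orthogonality relations in `t` gives `t (ln h_n)' = -S_n` and `t p_n' = r*_n`.
With `G_n = r*_n R_n - r_n S_n`, the pair `(S_n, G_n)` then solves a planar system which is rational
in `S_n`, `G_n`, `t`; eliminating `G_n` turns it into Painlevé V for `y = R_n / (2n + 1 + α + β)`.
Since `D_n` is the product of the `h_j`, `H_n = -∑_{j < n} S_j`; this sum telescopes to
`(2n + α + β) p_n + n (n + α - t)`, and `p_n` is recovered from `y` and `y'` through the quadratic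
relation satisfied by `G_n`. Finally `S_j > 0` fixes the sign of `H_n`, which makes `H_n / s`
integrable up to `0`.
-/

namespace PollaczekJacobi

noncomputable section

open Polynomial MeasureTheory Set

/-- The sequence `P` of monic polynomials, `P n` of degree `n`, is orthogonal with respect to the
moment functional `L`. -/
structure IsMonicOrthogonal {K : Type*} [CommRing K] (L : K[X] →ₗ[K] K) (P : ℕ → K[X]) : Prop where
  monic (n : ℕ) : (P n).Monic
  natDegree_eq (n : ℕ) : (P n).natDegree = n
  orthogonal {m n : ℕ} (h : m < n) : L (P n * P m) = 0

theorem map_C_mul {K : Type*} [CommRing K] (L : K[X] →ₗ[K] K) (a : K) (g : K[X]) :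
    L (C a * g) = a * L g := by
  rw [← smul_eq_C_mul, map_smul, smul_eq_mul]

theorem degree_lt_succ_of_natDegree_le {K : Type*} [CommRing K] {g : K[X]} {n : ℕ}
    (hg : g.natDegree ≤ n) : g.degree < (n + 1 : ℕ) :=
  (degree_lt_iff_coeff_zero _ _).2 fun _ hm => coeff_eq_zero_of_natDegree_lt (by lia)

theorem natDegree_le_of_degree_lt_succ {K : Type*} [CommRing K] {g : K[X]} {n : ℕ}
    (hg : g.degree < (n + 1 : ℕ)) : g.natDegree ≤ n :=
  natDegree_le_iff_coeff_eq_zero.2 fun m hm => (degree_lt_iff_coeff_zero _ _).1 hg m (by lia)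

namespace IsMonicOrthogonal

variable {K : Type*} [CommRing K] {L : K[X] →ₗ[K] K} {P : ℕ → K[X]}

theorem coeff_self (hP : IsMonicOrthogonal L P) (n : ℕ) : (P n).coeff n = 1 := by
  simpa only [hP.natDegree_eq] using (hP.monic n).coeff_natDegree

theorem coeff_of_lt (hP : IsMonicOrthogonal L P) {n k : ℕ} (h : n < k) : (P n).coeff k = 0 :=
  coeff_eq_zero_of_natDegree_lt ((hP.natDegree_eq n).trans_lt h)

theorem map_mul_eq_zero_of_ne (hP : IsMonicOrthogonal L P) {m n : ℕ} (h : m ≠ n) :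
    L (P m * P n) = 0 := by
  rcases lt_or_gt_of_ne h with h | h
  · rw [mul_comm, hP.orthogonal h]
  · exact hP.orthogonal h

theorem degree_sub_C_mul_lt (hP : IsMonicOrthogonal L P) {n : ℕ} {g : K[X]}
    (hg : g.degree < (n + 1 : ℕ)) : (g - C (g.coeff n) * P n).degree < n := by
  rw [degree_lt_iff_coeff_zero] at hg ⊢
  intro m hm
  rcases hm.eq_or_lt with rfl | h
  · rw [coeff_sub, coeff_C_mul, hP.coeff_self, mul_one, sub_self]
  · rw [coeff_sub, coeff_C_mul, hP.coeff_of_lt h, hg m h, mul_zero, sub_zero]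

theorem map_mul_of_degree_lt (hP : IsMonicOrthogonal L P) {n : ℕ} {g : K[X]}
    (hg : g.degree < n) : L (P n * g) = 0 := by
  suffices ∀ d ≤ n, ∀ g : K[X], g.degree < d → L (P n * g) = 0 from this n le_rfl g hg
  intro d hd
  induction d with
  | zero => intro g hg; rw [show g = 0 by simpa using hg, mul_zero, map_zero]
  | succ d ih =>
    intro g hg
    have h := ih (by lia) _ (hP.degree_sub_C_mul_lt hg)
    rwa [mul_sub, map_sub, mul_left_comm, map_C_mul, hP.orthogonal (by lia), mul_zero,
      sub_zero] at h

theorem map_mul (hP : IsMonicOrthogonal L P) {n : ℕ} {g : K[X]} (hg : g.natDegree ≤ n) :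
    L (P n * g) = g.coeff n * L (P n * P n) := by
  have h := hP.map_mul_of_degree_lt (hP.degree_sub_C_mul_lt (degree_lt_succ_of_natDegree_le hg))
  rwa [mul_sub, map_sub, mul_left_comm, map_C_mul, sub_eq_zero] at h

theorem map_mul_of_natDegree_le_succ (hP : IsMonicOrthogonal L P) {n : ℕ} {g : K[X]}
    (hg : g.natDegree ≤ n + 1) :
    L (P n * g) = (g.coeff n - g.coeff (n + 1) * (P (n + 1)).coeff n) * L (P n * P n) := by
  have hd : (g - C (g.coeff (n + 1)) * P (n + 1)).natDegree ≤ n := by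
    refine natDegree_le_iff_coeff_eq_zero.2 fun m hm => ?_
    rcases (Nat.succ_le_of_lt hm).eq_or_lt with rfl | h
    · rw [coeff_sub, coeff_C_mul, Nat.succ_eq_add_one, hP.coeff_self, mul_one, sub_self]
    · rw [coeff_sub, coeff_C_mul, hP.coeff_of_lt h, coeff_eq_zero_of_natDegree_lt (hg.trans_lt h),
        mul_zero, sub_zero]
  have h := hP.map_mul hd
  rwa [mul_sub, map_sub, mul_left_comm, map_C_mul, mul_comm (P n) (P (n + 1)),
    hP.orthogonal n.lt_succ_self, mul_zero, sub_zero, coeff_sub, coeff_C_mul] at h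

theorem eq_zero_of_degree_lt [NoZeroDivisors K] (hP : IsMonicOrthogonal L P)
    (hL : ∀ n, L (P n * P n) ≠ 0) {n : ℕ} {g : K[X]} (hg : g.degree < n)
    (h : ∀ m < n, L (P m * g) = 0) : g = 0 := by
  induction n with
  | zero => simpa using hg
  | succ n ih =>
    refine ih ?_ fun m hm => h m (by lia)
    have hc : g.coeff n = 0 := by
      have := h n n.lt_succ_self
      rw [hP.map_mul (natDegree_le_of_degree_lt_succ hg)] at this
      exact (mul_eq_zero.1 this).resolve_right (hL n)
    simpa [hc] using hP.degree_sub_C_mul_lt hg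

theorem natDegree_X_mul_le (hP : IsMonicOrthogonal L P) (n : ℕ) : (X * P n).natDegree ≤ n + 1 :=
  natDegree_mul_le.trans (by rw [hP.natDegree_eq, add_comm]; gcongr; exact natDegree_X_le)

theorem X_mul_eq [NoZeroDivisors K] (hP : IsMonicOrthogonal L P) (hL : ∀ n, L (P n * P n) ≠ 0)
    {n : ℕ} {a b : K} (ha : a = (P (n + 1)).coeff n - (P (n + 2)).coeff (n + 1))
    (hb : b * L (P n * P n) = L (P (n + 1) * P (n + 1))) :
    X * P (n + 1) = P (n + 2) + C a * P (n + 1) + C b * P n := by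
  rw [← sub_eq_zero]
  refine hP.eq_zero_of_degree_lt hL (n := n + 2) ?_ fun m hm => ?_
  · rw [degree_lt_iff_coeff_zero]
    intro k hk
    obtain ⟨k, rfl⟩ : ∃ j, k = j + 1 := ⟨k - 1, by lia⟩
    simp only [coeff_sub, coeff_add, coeff_C_mul, coeff_X_mul]
    rw [hP.coeff_of_lt (show n + 1 < k + 1 by lia), hP.coeff_of_lt (show n < k + 1 by lia)]
    rcases hk.eq_or_lt with h | h
    · obtain rfl : k = n + 1 := by lia
      rw [hP.coeff_self, hP.coeff_self]
      ring
    · rw [hP.coeff_of_lt (show n + 1 < k by lia), hP.coeff_of_lt h]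
      ring
  · have hX : P m * (X * P (n + 1)) = P (n + 1) * (X * P m) := by ring
    rw [mul_sub, mul_add, mul_add, hX, mul_left_comm (P m) (C a), mul_left_comm (P m) (C b),
      map_sub, map_add, map_add, map_C_mul, map_C_mul,
      hP.map_mul_eq_zero_of_ne (show m ≠ n + 2 by lia)]
    rcases lt_trichotomy m n with h | rfl | h
    · have hdeg := degree_lt_succ_of_natDegree_le ((hP.natDegree_X_mul_le m).trans h)
      rw [hP.map_mul_of_degree_lt hdeg, hP.map_mul_eq_zero_of_ne (show m ≠ n + 1 by lia),
        hP.map_mul_eq_zero_of_ne h.ne]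
      ring
    · rw [hP.map_mul (hP.natDegree_X_mul_le m), coeff_X_mul, hP.coeff_self,
        hP.map_mul_eq_zero_of_ne (Nat.succ_ne_self m).symm, hb]
      ring
    · obtain rfl : m = n + 1 := by lia
      rw [hP.map_mul_of_natDegree_le_succ (hP.natDegree_X_mul_le (n + 1)), coeff_X_mul, coeff_X_mul,
        hP.coeff_self, hP.orthogonal n.lt_succ_self, ha]
      ring

theorem det_hankel (hP : IsMonicOrthogonal L P) (n : ℕ) :
    (Matrix.of fun j k : Fin n => L (X ^ ((j : ℕ) + (k : ℕ)))).det =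
      ∏ j ∈ Finset.range n, L (P j * P j) := by
  set H := Matrix.of fun j k : Fin n => L (X ^ ((j : ℕ) + (k : ℕ)))
  let A : Matrix (Fin n) (Fin n) K := Matrix.of fun k j => (P j).coeff k
  have hA : A.det = 1 := Matrix.det_matrixOfPolynomials _ (fun j => hP.natDegree_eq j)
    fun j => hP.monic j
  have map_mul_eq_sum (j : Fin n) (g : K[X]) :
      L (P j * g) = ∑ k : Fin n, (P j).coeff k * L (X ^ (k : ℕ) * g) := by
    rw [← Finset.sum_range fun k => (P j).coeff k * L (X ^ k * g)]
    conv_lhs => rw [(P j).as_sum_range_C_mul_X_pow' (n := n) (by rw [hP.natDegree_eq]; exact j.2)]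
    simp only [Finset.sum_mul, map_sum, mul_assoc, map_C_mul]
  have gram : A.transpose * H * A = Matrix.diagonal fun j : Fin n => L (P j * P j) := by
    ext i j
    trans L (P i * P j)
    · rw [Matrix.mul_assoc, Matrix.mul_apply, map_mul_eq_sum i]
      refine Finset.sum_congr rfl fun k _ => congrArg _ ?_
      rw [Matrix.mul_apply, mul_comm (X ^ _), map_mul_eq_sum j]
      refine Finset.sum_congr rfl fun l _ => ?_
      rw [mul_comm, ← pow_add, add_comm]
      rfl
    · obtain rfl | h := eq_or_ne i j
      · rw [Matrix.diagonal_apply_eq]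
      · rw [Matrix.diagonal_apply_ne _ h, hP.map_mul_eq_zero_of_ne (Fin.val_ne_of_ne h)]
  have := congrArg Matrix.det gram
  rwa [Matrix.det_mul, Matrix.det_mul, Matrix.det_transpose, hA, Matrix.det_diagonal, one_mul,
    mul_one, ← Finset.prod_range fun j => L (P j * P j)] at this

end IsMonicOrthogonal

section Quotient

variable {K : Type*} [Field K] {a : K}

theorem map_mul_eq_eval_mul_add {L M : K[X] →ₗ[K] K} (hM : ∀ g, M ((X - C a) * g) = L g)
    (p g : K[X]) :
    M (p * g) = g.eval a * M p + L (p * (g /ₘ (X - C a))) := by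
  conv_lhs => rw [← modByMonic_add_div g (X - C a), modByMonic_X_sub_C_eq_C_eval]
  rw [mul_add, map_add, mul_comm p (C _), map_C_mul, mul_left_comm, hM]

theorem natDegree_divByMonic_X_sub_C_le {g : K[X]} {n : ℕ} (hg : g.natDegree ≤ n + 1) :
    (g /ₘ (X - C a)).natDegree ≤ n := by
  rw [natDegree_divByMonic _ (monic_X_sub_C a), natDegree_X_sub_C]
  lia

theorem coeff_divByMonic_X_sub_C_of_natDegree_le {g : K[X]} {n : ℕ} (hg : g.natDegree ≤ n + 1) :
    (g /ₘ (X - C a)).coeff n = g.coeff (n + 1) := by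
  rw [coeff_divByMonic_X_sub_C_rec, coeff_eq_zero_of_natDegree_lt (p := g /ₘ (X - C a)), mul_zero,
    add_zero]
  exact (natDegree_divByMonic_X_sub_C_le hg).trans_lt n.lt_succ_self

theorem eval_divByMonic_X_sub_C (g : K[X]) (a : K) :
    (g /ₘ (X - C a)).eval a = (derivative g).eval a := by
  conv_rhs => rw [← modByMonic_add_div g (X - C a), modByMonic_X_sub_C_eq_C_eval]
  simp [derivative_mul]

end Quotient

namespace IsMonicOrthogonal

variable {K : Type*} [Field K] {L M M₂ : K[X] →ₗ[K] K} {P : ℕ → K[X]} {a : K}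

theorem quotient_map_mul (hP : IsMonicOrthogonal L P) (hM : ∀ g, M ((X - C a) * g) = L g)
    {n : ℕ} {g : K[X]} (hg : g.natDegree ≤ n + 1) :
    M (P n * g) = g.eval a * M (P n) + g.coeff (n + 1) * L (P n * P n) := by
  rw [map_mul_eq_eval_mul_add hM, hP.map_mul (natDegree_divByMonic_X_sub_C_le hg),
    coeff_divByMonic_X_sub_C_of_natDegree_le hg]

theorem quotient_quotient_map_mul (hP : IsMonicOrthogonal L P)
    (hM : ∀ g, M ((X - C a) * g) = L g) (hM₂ : ∀ g, M₂ ((X - C a) * g) = M g)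
    {n : ℕ} {g : K[X]} (hg : g.natDegree ≤ n + 1) :
    M₂ (P n * g) = g.eval a * M₂ (P n) + (derivative g).eval a * M (P n) := by
  have hq := natDegree_divByMonic_X_sub_C_le (a := a) hg
  rw [map_mul_eq_eval_mul_add hM₂, hP.quotient_map_mul hM (hq.trans n.le_succ),
    eval_divByMonic_X_sub_C, coeff_eq_zero_of_natDegree_lt (by lia), zero_mul, add_zero]

/- Both sides are `P n (a) P (n + 1) (a) M (P n) M (P (n + 1))`. -/
theorem quotient_casoratian (hP : IsMonicOrthogonal L P) (hM : ∀ g, M ((X - C a) * g) = L g)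
    (n : ℕ) :
    M (P (n + 1) * P n) * (M (P (n + 1) * P n) - L (P n * P n)) =
      M (P (n + 1) * P (n + 1)) * M (P n * P n) := by
  have h₁ := hP.quotient_map_mul hM (n := n + 1) (g := P n) (by rw [hP.natDegree_eq]; lia)
  have h₂ := hP.quotient_map_mul hM (n := n) (g := P (n + 1)) (by rw [hP.natDegree_eq])
  have h₃ := hP.quotient_map_mul hM (n := n) (g := P n) (by rw [hP.natDegree_eq]; lia)
  have h₄ := hP.quotient_map_mul hM (n := n + 1) (g := P (n + 1)) (by rw [hP.natDegree_eq]; lia)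
  rw [mul_comm (P n)] at h₂
  rw [hP.coeff_of_lt (by lia)] at h₁ h₃ h₄
  rw [hP.coeff_self] at h₂
  rw [h₃, h₄]
  linear_combination (M (P (n + 1) * P n) - L (P n * P n)) * h₁ +
    eval a (P n) * M (P (n + 1)) * h₂

theorem quotient_casoratian_polar (hP : IsMonicOrthogonal L P)
    (hM : ∀ g, M ((X - C a) * g) = L g) (hM₂ : ∀ g, M₂ ((X - C a) * g) = M g) (n : ℕ) :
    M₂ (P (n + 1) * P n) * (2 * M (P (n + 1) * P n) - L (P n * P n)) =
      M₂ (P (n + 1) * P (n + 1)) * M (P n * P n) +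
        M (P (n + 1) * P (n + 1)) * M₂ (P n * P n) := by
  have hd : (P n).natDegree ≤ n + 1 := by rw [hP.natDegree_eq]; lia
  have hd' : (P n).natDegree ≤ n + 2 := by rw [hP.natDegree_eq]; lia
  have hd₁ : (P (n + 1)).natDegree ≤ n + 1 := by rw [hP.natDegree_eq]
  have hd₂ : (P (n + 1)).natDegree ≤ n + 2 := by rw [hP.natDegree_eq]; lia
  have h₁ := hP.quotient_map_mul hM (n := n + 1) hd'
  have h₂ := hP.quotient_map_mul hM hd₁
  rw [hP.coeff_of_lt (by lia)] at h₁
  rw [hP.coeff_self, mul_comm (P n)] at h₂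
  have k₁ := hP.quotient_quotient_map_mul hM hM₂ (n := n + 1) hd'
  have k₂ := hP.quotient_quotient_map_mul hM hM₂ hd₁
  rw [mul_comm (P n)] at k₂
  rw [hP.quotient_map_mul hM hd, hP.quotient_quotient_map_mul hM hM₂ hd,
    hP.quotient_map_mul hM hd₂, hP.quotient_quotient_map_mul hM hM₂ hd₂,
    hP.coeff_of_lt (show n < n + 1 by lia), hP.coeff_of_lt (show n + 1 < n + 1 + 1 by lia)]
  linear_combination M₂ (P (n + 1) * P n) * h₁ + M₂ (P (n + 1) * P n) * h₂ +
    eval a (P (n + 1)) * M (P n) * k₁ + eval a (P n) * M (P (n + 1)) * k₂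

end IsMonicOrthogonal

/-- The algebraic data behind the Pollaczek-Jacobi weight `w = x ^ α (1 - x) ^ β e ^ (-t / x)`:
the functionals `L`, `L₁`, `L₂`, `V` stand for integration against `w`, `w / x`, `w / x ^ 2` and
`w / (x - 1)`, the polynomials `P n` are the monic orthogonal polynomials of `L`, and `pearson` is
the Pearson equation `w' = (α / x + β / (x - 1) + t / x ^ 2) w` integrated by parts. -/
structure PearsonSystem (K : Type*) [Field K] where
  α : K
  β : K
  t : K
  L : K[X] →ₗ[K] K
  L₁ : K[X] →ₗ[K] K
  L₂ : K[X] →ₗ[K] K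
  V : K[X] →ₗ[K] K
  P : ℕ → K[X]
  isMonicOrthogonal : IsMonicOrthogonal L P
  map_mul_self_ne_zero (n : ℕ) : L (P n * P n) ≠ 0
  L₁_X_mul (g : K[X]) : L₁ (X * g) = L g
  L₂_X_mul (g : K[X]) : L₂ (X * g) = L₁ g
  V_X_sub_C_mul (g : K[X]) : V ((X - C 1) * g) = L g
  pearson (g : K[X]) : L (derivative g) + α * L₁ g + β * V g + t * L₂ g = 0

theorem coeff_X_mul_derivative {K : Type*} [CommRing K] (p : K[X]) (k : ℕ) :
    (X * derivative p).coeff k = k * p.coeff k := by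
  cases k with
  | zero => simp
  | succ k => rw [coeff_X_mul, coeff_derivative, mul_comm, Nat.cast_succ]

theorem natDegree_X_mul_derivative_le {K : Type*} [CommRing K] (p : K[X]) :
    (X * derivative p).natDegree ≤ p.natDegree :=
  natDegree_le_iff_coeff_eq_zero.2 fun m hm => by
    rw [coeff_X_mul_derivative, coeff_eq_zero_of_natDegree_lt hm, mul_zero]

namespace PearsonSystem

variable {K : Type*} [Field K] (s : PearsonSystem K) (n : ℕ)

/-- The squared norm `h_n = ∫ P_n ^ 2 w`. -/
def h : K := s.L (s.P n * s.P n)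

/-- `R_n = (β / h_n) ∫ P_n ^ 2 w / (1 - x)`. -/
def R : K := -(s.β * s.V (s.P n * s.P n)) / s.h n

/-- `S_n = (t / h_n) ∫ P_n ^ 2 w / x`, the companion of `R_n` at the other endpoint. -/
def S : K := s.t * s.L₁ (s.P n * s.P n) / s.h n

/-- `(β / h_n) ∫ P_(n+1) P_n w / (1 - x)`, which is `r_(n+1)` in the usual indexing. -/
def r : K := -(s.β * s.V (s.P (n + 1) * s.P n)) / s.h n

/-- `(t / h_n) ∫ P_(n+1) P_n w / x`, which is `r*_(n+1)` in the usual indexing. -/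
def rStar : K := s.t * s.L₁ (s.P (n + 1) * s.P n) / s.h n

/-- The recurrence coefficient `h_(n+1) / h_n`. -/
def b : K := s.h (n + 1) / s.h n

/-- The coefficient of `x ^ (n - 1)` in `P_n`, and `0` for `n = 0`. -/
def p : K := (X * s.P n).coeff n

theorem h_ne_zero : s.h n ≠ 0 := s.map_mul_self_ne_zero n

theorem p_succ : s.p (n + 1) = (s.P (n + 1)).coeff n := coeff_X_mul _ _

theorem b_mul_h : s.b n * s.h n = s.h (n + 1) := div_mul_cancel₀ _ (s.h_ne_zero n)

theorem S_mul_h : s.S n * s.h n = s.t * s.L₁ (s.P n * s.P n) :=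
  div_mul_cancel₀ _ (s.h_ne_zero n)

theorem R_mul_h : s.R n * s.h n = -(s.β * s.V (s.P n * s.P n)) :=
  div_mul_cancel₀ _ (s.h_ne_zero n)

theorem r_mul_h : s.r n * s.h n = -(s.β * s.V (s.P (n + 1) * s.P n)) :=
  div_mul_cancel₀ _ (s.h_ne_zero n)

theorem rStar_mul_h : s.rStar n * s.h n = s.t * s.L₁ (s.P (n + 1) * s.P n) :=
  div_mul_cancel₀ _ (s.h_ne_zero n)

theorem L_mul {g : K[X]} (hg : g.natDegree ≤ n) : s.L (s.P n * g) = g.coeff n * s.h n :=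
  s.isMonicOrthogonal.map_mul hg

theorem L_mul_of_natDegree_le_succ {g : K[X]} (hg : g.natDegree ≤ n + 1) :
    s.L (s.P n * g) = (g.coeff n - g.coeff (n + 1) * s.p (n + 1)) * s.h n := by
  rw [p_succ]
  exact s.isMonicOrthogonal.map_mul_of_natDegree_le_succ hg

theorem V_X_mul (g : K[X]) : s.V (X * g) = s.L g + s.V g := by
  rw [← s.V_X_sub_C_mul, C_1, sub_mul, one_mul, map_sub, sub_add_cancel]

/- The Pearson equation on `X * g`. -/
theorem euler (g : K[X]) :
    s.L (X * derivative g) + (1 + s.α + s.β) * s.L g + s.β * s.V g + s.t * s.L₁ g = 0 := by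
  have key := s.pearson (X * g)
  rw [derivative_mul, derivative_X, one_mul, map_add, s.L₁_X_mul, s.L₂_X_mul, s.V_X_mul] at key
  linear_combination key

theorem natDegree_X_mul_derivative_P_le :
    (X * derivative (s.P n)).natDegree ≤ n :=
  (natDegree_X_mul_derivative_le _).trans (s.isMonicOrthogonal.natDegree_eq n).le

theorem L_mul_X_mul_derivative : s.L (s.P n * (X * derivative (s.P n))) = n * s.h n := by
  rw [s.L_mul n (s.natDegree_X_mul_derivative_P_le n), coeff_X_mul_derivative,
    s.isMonicOrthogonal.coeff_self, mul_one]

theorem R_eq_S_add : s.R n = s.S n + (2 * n + 1 + s.α + s.β) := by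
  have key := s.euler (s.P n * s.P n)
  rw [derivative_mul, show X * (derivative (s.P n) * s.P n + s.P n * derivative (s.P n)) =
      s.P n * (X * derivative (s.P n)) + s.P n * (X * derivative (s.P n)) by ring, map_add,
    L_mul_X_mul_derivative, ← h] at key
  refine mul_right_cancel₀ (s.h_ne_zero n) ?_
  linear_combination s.R_mul_h n - s.S_mul_h n - key

theorem rStar_sub_r : s.rStar n - s.r n = s.p (n + 1) := by
  have hP := s.isMonicOrthogonal
  have key := s.euler (s.P (n + 1) * s.P n)
  have hlow : s.L (s.P (n + 1) * (X * derivative (s.P n))) = 0 := hP.map_mul_of_degree_lt <|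
    degree_lt_succ_of_natDegree_le (s.natDegree_X_mul_derivative_P_le n)
  have hhigh := s.L_mul_of_natDegree_le_succ n (s.natDegree_X_mul_derivative_P_le (n + 1))
  rw [coeff_X_mul_derivative, coeff_X_mul_derivative, hP.coeff_self, ← p_succ] at hhigh
  rw [derivative_mul, show X * (derivative (s.P (n + 1)) * s.P n + s.P (n + 1) *
      derivative (s.P n)) = s.P n * (X * derivative (s.P (n + 1))) + s.P (n + 1) *
      (X * derivative (s.P n)) by ring, map_add, hlow, hP.orthogonal n.lt_succ_self] at key
  refine mul_right_cancel₀ (s.h_ne_zero n) ?_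
  push_cast at hhigh
  linear_combination s.rStar_mul_h n - s.r_mul_h n + key - hhigh

theorem L_mul_derivative_eq_zero {m : ℕ} (h : m ≤ n) : s.L (s.P n * derivative (s.P m)) = 0 := by
  have hP := s.isMonicOrthogonal
  refine hP.map_mul_of_degree_lt ((degree_derivative_lt (hP.monic m).ne_zero).trans_le ?_)
  rw [degree_eq_natDegree (hP.monic m).ne_zero, hP.natDegree_eq]
  exact_mod_cast h

theorem R_mul_h_eq : s.R n * s.h n =
    s.α * s.L₁ (s.P n * s.P n) + s.t * s.L₂ (s.P n * s.P n) := by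
  have key := s.pearson (s.P n * s.P n)
  rw [derivative_mul, mul_comm (derivative _), map_add, s.L_mul_derivative_eq_zero n le_rfl] at key
  linear_combination s.R_mul_h n - key

theorem r_sub_mul_h_eq : (s.r n - (n + 1)) * s.h n =
    s.α * s.L₁ (s.P (n + 1) * s.P n) + s.t * s.L₂ (s.P (n + 1) * s.P n) := by
  have hP := s.isMonicOrthogonal
  have hd : (derivative (s.P (n + 1))).natDegree ≤ n :=
    (natDegree_derivative_le _).trans (by rw [hP.natDegree_eq]; lia)
  have key := s.pearson (s.P (n + 1) * s.P n)
  rw [derivative_mul, mul_comm (derivative _), map_add,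
    s.L_mul_derivative_eq_zero (n + 1) n.le_succ, s.L_mul n hd, coeff_derivative,
    hP.coeff_self] at key
  linear_combination s.r_mul_h n - key

theorem R_eq_p : s.R n = (2 * n + 2 + s.α + s.β) * (s.p n - s.p (n + 1)) - 2 * s.p n +
    s.β + s.t := by
  have hP := s.isMonicOrthogonal
  have hd : (X * s.P n).natDegree ≤ n + 1 := hP.natDegree_X_mul_le n
  have hL : s.L (s.P n * (X * s.P n)) = (s.p n - s.p (n + 1)) * s.h n := by
    rw [s.L_mul_of_natDegree_le_succ n hd, coeff_X_mul _ n, hP.coeff_self, one_mul, ← p]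
  have hL' : s.L (s.P n * (X * derivative (X * s.P n))) =
      (n * s.p n - (n + 1) * s.p (n + 1)) * s.h n := by
    rw [s.L_mul_of_natDegree_le_succ n ((natDegree_X_mul_derivative_le _).trans hd),
      coeff_X_mul_derivative, coeff_X_mul_derivative, coeff_X_mul _ n, hP.coeff_self, ← p]
    push_cast
    ring
  have hderiv : X * derivative (X * (s.P n * s.P n)) =
      2 * (s.P n * (X * derivative (X * s.P n))) - s.P n * (X * s.P n) := by
    simp only [derivative_mul, derivative_X]
    ring
  have key := s.euler (X * (s.P n * s.P n))
  rw [hderiv, two_mul, map_sub, map_add, hL', s.V_X_mul, s.L₁_X_mul, mul_left_comm X, hL,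
    ← h] at key
  refine mul_right_cancel₀ (s.h_ne_zero n) ?_
  linear_combination s.R_mul_h n - key

theorem S_eq_p : s.S n = (2 * n + s.α + s.β) * s.p n -
    (2 * (n + 1) + s.α + s.β) * s.p (n + 1) + s.t - (2 * n + 1 + s.α) := by
  linear_combination s.R_eq_p n - s.R_eq_S_add n

theorem sum_S : ∑ j ∈ Finset.range n, s.S j =
    -((2 * n + s.α + s.β) * s.p n + n * (n + s.α - s.t)) := by
  induction n with
  | zero => simp [p]
  | succ n ih =>
    rw [Finset.sum_range_succ, ih, S_eq_p]
    push_cast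
    ring

theorem rStar_mul_rStar_sub : s.rStar n * (s.rStar n - s.t) = s.b n * s.S (n + 1) * s.S n := by
  have key := s.isMonicOrthogonal.quotient_casoratian (M := s.L₁) (a := 0)
    (by simpa using s.L₁_X_mul) n
  simp only [rStar, b, S, h] at *
  have h₀ := s.map_mul_self_ne_zero n
  have h₁ := s.map_mul_self_ne_zero (n + 1)
  field_simp
  linear_combination s.t ^ 2 * key

theorem r_mul_r_add : s.r n * (s.r n + s.β) = s.b n * s.R (n + 1) * s.R n := by
  have key := s.isMonicOrthogonal.quotient_casoratian s.V_X_sub_C_mul n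
  simp only [r, b, R, h] at *
  have h₀ := s.map_mul_self_ne_zero n
  have h₁ := s.map_mul_self_ne_zero (n + 1)
  field_simp
  linear_combination s.β ^ 2 * key

theorem two_mul_rStar_sub_mul : (2 * s.rStar n - s.t) * (s.r n - (n + 1)) - s.α * s.rStar n =
    s.b n * (s.R (n + 1) * s.S n + s.S (n + 1) * s.R n) := by
  have polar : s.L₂ (s.P (n + 1) * s.P n) * (2 * s.L₁ (s.P (n + 1) * s.P n) - s.h n) = _ :=
    s.isMonicOrthogonal.quotient_casoratian_polar (a := 0) (by simpa using s.L₁_X_mul)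
      (by simpa using s.L₂_X_mul) n
  have cas : s.L₁ (s.P (n + 1) * s.P n) * (s.L₁ (s.P (n + 1) * s.P n) - s.h n) = _ :=
    s.isMonicOrthogonal.quotient_casoratian (a := 0) (by simpa using s.L₁_X_mul) n
  refine mul_right_cancel₀ (pow_ne_zero 2 (s.h_ne_zero n)) ?_
  trans s.t * (2 * s.α * (s.L₁ (s.P (n + 1) * s.P n) * (s.L₁ (s.P (n + 1) * s.P n) - s.h n)) +
    s.t * (s.L₂ (s.P (n + 1) * s.P n) * (2 * s.L₁ (s.P (n + 1) * s.P n) - s.h n)))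
  · linear_combination (2 * s.rStar n - s.t) * s.h n * s.r_sub_mul_h_eq n +
      (2 * (s.α * s.L₁ (s.P (n + 1) * s.P n) + s.t * s.L₂ (s.P (n + 1) * s.P n)) -
        s.α * s.h n) * s.rStar_mul_h n
  · rw [cas, polar]
    linear_combination -s.h n * (s.R (n + 1) * s.S n + s.S (n + 1) * s.R n) * s.b_mul_h n -
      s.S n * s.h n * s.R_mul_h_eq (n + 1) -
      (s.α * s.L₁ (s.P (n + 1) * s.P (n + 1)) + s.t * s.L₂ (s.P (n + 1) * s.P (n + 1))) *
        s.S_mul_h n - s.R n * s.h n * s.S_mul_h (n + 1) -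
      s.t * s.L₁ (s.P (n + 1) * s.P (n + 1)) * s.R_mul_h_eq n

theorem rStar_succ_add_rStar : s.rStar (n + 1) + (s.p (n + 1) - s.p (n + 2)) * s.S (n + 1) +
    s.rStar n = s.t := by
  have recurrence := s.isMonicOrthogonal.X_mul_eq s.map_mul_self_ne_zero (n := n) rfl (s.b_mul_h n)
  have key := congrArg (fun g => s.t * s.L₁ (g * s.P (n + 1))) recurrence
  simp only [mul_assoc, s.L₁_X_mul, add_mul, map_add, map_C_mul, mul_comm (s.P n)] at key
  rw [show s.L (s.P (n + 1) * s.P (n + 1)) = s.h (n + 1) from rfl] at key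
  refine mul_right_cancel₀ (s.h_ne_zero (n + 1)) ?_
  rw [p_succ, p_succ]
  linear_combination s.rStar_mul_h (n + 1) - s.rStar n * s.b_mul_h n + s.b n * s.rStar_mul_h n +
    ((s.P (n + 1)).coeff n - (s.P (n + 2)).coeff (n + 1)) * s.S_mul_h (n + 1) - key

end PearsonSystem

namespace PearsonSystem

variable {K : Type*} [Field K] (s : PearsonSystem K) (n : ℕ)

/-- The combination `r*_(n+1) R_(n+1) - r_(n+1) S_(n+1)`: the pair `(S_(n+1), G)` evolves
autonomously in `t`. -/
def G : K := s.rStar n * s.R (n + 1) - s.r n * s.S (n + 1)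

theorem R_succ_eq_S_add : s.R (n + 1) = s.S (n + 1) + (2 * n + 3 + s.α + s.β) := by
  rw [R_eq_S_add]
  push_cast
  ring

theorem G_eq : s.G n = (2 * n + 3 + s.α + s.β) * s.rStar n + s.p (n + 1) * s.S (n + 1) := by
  rw [G, R_succ_eq_S_add]
  linear_combination s.S (n + 1) * s.rStar_sub_r n

theorem G_quadratic : s.G n ^ 2 - s.t * s.R (n + 1) * s.G n - s.β * s.S (n + 1) * s.G n +
    (2 * n + 2 + s.α + s.β) * s.rStar n * s.R (n + 1) * s.S (n + 1) -
    (n + 1) * s.t * s.R (n + 1) * s.S (n + 1) = 0 := by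
  rw [G]
  linear_combination s.R (n + 1) ^ 2 * s.rStar_mul_rStar_sub n +
    s.S (n + 1) ^ 2 * s.r_mul_r_add n - s.R (n + 1) * s.S (n + 1) * s.two_mul_rStar_sub_mul n

theorem mul_b_eq : (2 * n + 3 + s.α + s.β) * (2 * n + 1 + s.α + s.β) * s.b n =
    s.p (n + 1) ^ 2 - (s.t + s.β) * s.p (n + 1) + (2 * n + 2 + s.α + s.β) * s.rStar n -
      (n + 1) * s.t := by
  have hr : s.r n = s.rStar n - s.p (n + 1) := by linear_combination -s.rStar_sub_r n
  have h₁ := s.rStar_mul_rStar_sub n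
  have h₂ := s.r_mul_r_add n
  have h₃ := s.two_mul_rStar_sub_mul n
  rw [R_succ_eq_S_add, R_eq_S_add, hr] at *
  linear_combination h₃ - h₁ - h₂

theorem riccati : (2 * n + 2 + s.α + s.β) * s.rStar n -
    (2 * n + 4 + s.α + s.β) * s.rStar (n + 1) + s.t =
    2 * s.G n + s.S (n + 1) * (s.R (n + 1) - s.β) - s.t * s.R (n + 1) := by
  have hR := s.R_eq_p (n + 1)
  push_cast at hR
  rw [G_eq]
  linear_combination -(2 * n + 4 + s.α + s.β) * s.rStar_succ_add_rStar n -
    s.S (n + 1) * hR + s.t * s.R_succ_eq_S_add n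

/- Here `δ` plays the role of `t r*'`, obtained by differentiating `mul_b_eq`. -/
theorem G_evolution (hR : s.R (n + 1) ≠ 0) (hS : s.S (n + 1) ≠ 0)
    (hν : 2 * n + 2 + s.α + s.β ≠ 0) {δ : K}
    (hδ : (2 * s.p (n + 1) - (s.t + s.β)) * s.rStar n - s.t * s.p (n + 1) +
      (2 * n + 2 + s.α + s.β) * δ - (n + 1) * s.t =
      (2 * n + 3 + s.α + s.β) * (2 * n + 1 + s.α + s.β) * (s.b n * (s.S n - s.S (n + 1)))) :
    (2 * n + 3 + s.α + s.β) * δ + s.rStar n * s.S (n + 1) + s.p (n + 1) *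
      (2 * s.G n + s.S (n + 1) * (s.R (n + 1) - s.β) - s.t * s.R (n + 1)) =
    s.G n ^ 2 * (1 / s.R (n + 1) + 2 / s.S (n + 1)) + s.G n * (s.R (n + 1) - s.β -
      s.β * s.S (n + 1) / s.R (n + 1) - 2 * s.t * s.R (n + 1) / s.S (n + 1)) -
      (n + 1) * s.t * s.R (n + 1) := by
  have hRS := s.R_succ_eq_S_add n
  have hb := s.mul_b_eq n
  have hbS := s.rStar_mul_rStar_sub n
  have hQ := s.G_quadratic n
  have hG := s.G_eq n
  obtain ⟨N, hN⟩ : ∃ N, 2 * n + 3 + s.α + s.β = N := ⟨_, rfl⟩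
  have hN₁ : 2 * n + 2 + s.α + s.β = N - 1 := by linear_combination hN
  have hN₂ : 2 * n + 1 + s.α + s.β = N - 2 := by linear_combination hN
  rw [hN] at hRS hb hδ hG ⊢
  rw [hN₁] at hb hδ hQ hν
  rw [hN₂] at hb hδ
  refine mul_left_cancel₀ hν (sub_eq_zero.1 ?_)
  generalize s.S (n + 1) = S, s.S n = S', s.b n = b, s.G n = G, s.R (n + 1) = R, s.rStar n = ρ,
    s.p (n + 1) = p, s.t = t, s.β = β at *
  subst hRS hG
  field_simp
  linear_combination N * S * (S + N) * hδ - N * S ^ 2 * (S + N) * hb -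
    N ^ 2 * (N - 2) * (S + N) * hbS - (N * (S + N) + (N - 1) * S) * hQ

end PearsonSystem

/-- The velocity `t S'` of the first coordinate in the planar system for `(S, G) = (S_n, G_n)`;
here `N = 2n + 1 + α + β`, so that `S + N = R_n`. -/
def velocityS (N β t S G : ℝ) : ℝ :=
  2 * G + S * (S + N - β) - t * (S + N)

/-- The velocity `t G'` of the second coordinate in the planar system for `(S_n, G_n)`. -/
def velocityG (n N β t S G : ℝ) : ℝ :=
  G ^ 2 * (1 / (S + N) + 2 / S) +
    G * (S + N - β - β * S / (S + N) - 2 * t * (S + N) / S) - n * t * (S + N)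

theorem painleveV_of_velocity {n N β t S G : ℝ} (hS : S ≠ 0) (hN : N ≠ 0) (hR : S + N ≠ 0)
    (ht : t ≠ 0) {y W : ℝ} (hy : y = (S + N) / N) (hW : W = velocityS N β t S G) :
    (((2 * velocityG n N β t S G + W * (2 * S + N - β - t)) / t - (S + N)) / N * t - W / N) /
        t ^ 2 =
      (1 / (2 * y) + 1 / (y - 1)) * (W / N / t) ^ 2 - W / N / t / t +
        (y - 1) ^ 2 / t ^ 2 * (N ^ 2 / 2 * y + -β ^ 2 / 2 / y) + (N - 1 - 2 * n - β) * y / t +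
        -1 / 2 * y * (y + 1) / (y - 1) := by
  have hy₁ : y - 1 = S / N := by rw [hy]; field_simp; ring
  rw [hy₁, hy, hW, velocityS, velocityG]
  field_simp
  ring

/-- The pair `(S, G)` solves on `t > 0` the planar system with velocities `velocityS` and
`velocityG`. -/
structure IsPlanarFlow (n N β : ℝ) (S G : ℝ → ℝ) : Prop where
  hasDerivAt_fst {t : ℝ} (ht : 0 < t) : HasDerivAt S (velocityS N β t (S t) (G t) / t) t
  hasDerivAt_snd {t : ℝ} (ht : 0 < t) : HasDerivAt G (velocityG n N β t (S t) (G t) / t) t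

namespace IsPlanarFlow

variable {n N β : ℝ} {S G : ℝ → ℝ}

theorem hasDerivAt_div (h : IsPlanarFlow n N β S G) {t : ℝ} (ht : 0 < t) :
    HasDerivAt (fun s => (S s + N) / N) (velocityS N β t (S t) (G t) / N / t) t :=
  (((h.hasDerivAt_fst ht).add_const N).div_const N).congr_deriv (by ring)

theorem hasDerivAt_velocityS (h : IsPlanarFlow n N β S G) {t : ℝ} (ht : 0 < t) :
    HasDerivAt (fun s => velocityS N β s (S s) (G s))
      ((2 * velocityG n N β t (S t) (G t) +
        velocityS N β t (S t) (G t) * (2 * S t + N - β - t)) / t - (S t + N)) t := by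
  have hS := h.hasDerivAt_fst ht
  refine ((((h.hasDerivAt_snd ht).const_mul 2).add
    (hS.mul ((hS.add_const N).sub_const β))).sub
      ((hasDerivAt_id t).mul (hS.add_const N))).congr_deriv ?_
  simp only [id]
  field_simp
  ring

theorem solvesPV (h : IsPlanarFlow n N β S G) (hS : ∀ t, 0 < t → 0 < S t) (hN : 0 < N) :
    SolvesPV (N ^ 2 / 2) (-β ^ 2 / 2) (N - 1 - 2 * n - β) (-1 / 2) (fun t => (S t + N) / N) := by
  intro t ht
  have hSt := hS t ht
  have hderiv : deriv (fun s => (S s + N) / N) =ᶠ[𝓝 t] fun s =>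
      velocityS N β s (S s) (G s) / N / s := by
    filter_upwards [Ioi_mem_nhds ht] with s hs using (h.hasDerivAt_div hs).deriv
  have hderiv₂ := (((h.hasDerivAt_velocityS ht).div_const N).div (hasDerivAt_id t)
    ht.ne').congr_of_eventuallyEq hderiv
  refine ⟨by positivity, ?_, (h.hasDerivAt_div ht).differentiableAt, hderiv₂.differentiableAt, ?_⟩
  · rw [Ne, div_eq_one_iff_eq hN.ne', add_eq_right]
    exact hSt.ne'
  · rw [hderiv₂.deriv, hderiv.eq_of_nhds]
    simpa only [id, mul_one] using
      painleveV_of_velocity hSt.ne' hN.ne' (add_pos hSt hN).ne' ht.ne' rfl rfl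

end IsPlanarFlow

theorem HExpr_eq_of_quadratic {n : ℕ} {α β t S G ρ p N : ℝ} (ht : t ≠ 0) (hS : S ≠ 0)
    (hR : S + N ≠ 0) (hN : N = 2 * n + 1 + α + β) (hN₀ : N ≠ 0) (hG : G = N * ρ + p * S)
    (hquad : G ^ 2 - t * (S + N) * G - β * S * G + (2 * n + α + β) * ρ * (S + N) * S -
      n * t * (S + N) * S = 0) :
    HExpr n α β t ((S + N) / N) (velocityS N β t S G / N / t) =
      (2 * n + α + β) * p + n * (n + α - t) := by
  have hp : p = (G - N * ρ) / S := by field_simp; linear_combination -hG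
  have hα : α = N - 1 - 2 * n - β := by linear_combination -hN
  have hy₁ : (S + N) / N - 1 = S / N := by field_simp; ring
  rw [HExpr, velocityS, hy₁, hp, hα]
  rw [hα] at hquad
  field_simp
  linear_combination 4 * N ^ 2 * hquad

theorem rStarExpr_eq_of_HExpr_eq {n : ℕ} {α β t S G ρ p N : ℝ} (ht : t ≠ 0)
    (hN : N = 2 * n + 1 + α + β) (hN₀ : N ≠ 0) (hν : 2 * n + α + β ≠ 0) (hG : G = N * ρ + p * S)
    (hH : HExpr n α β t ((S + N) / N) (velocityS N β t S G / N / t) =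
      (2 * n + α + β) * p + n * (n + α - t)) :
    rStarExpr n α β t ((S + N) / N) (velocityS N β t S G / N / t) = ρ := by
  rw [rStarExpr, hH, ← hN, hG, velocityS]
  field_simp
  ring

/-- The moment functional `g ↦ ∫₀¹ g(x) φ(x) dx` of a density `φ`, assembled from the moments so
that it is linear whether or not `φ` is integrable. -/
def momentFunctional (φ : ℝ → ℝ) : ℝ[X] →ₗ[ℝ] ℝ :=
  Polynomial.lsum fun i => (∫ x in (0 : ℝ)..1, x ^ i * φ x) • LinearMap.id

theorem momentFunctional_X_pow (φ : ℝ → ℝ) (i : ℕ) :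
    momentFunctional φ (X ^ i) = ∫ x in (0 : ℝ)..1, x ^ i * φ x := by
  simp [momentFunctional, ← monomial_one_right_eq_X_pow, sum_monomial_index]

theorem map_eq_sum_of_natDegree_le {K : Type*} [CommRing K] (L : K[X] →ₗ[K] K) {g : K[X]} {d : ℕ}
    (hd : g.natDegree ≤ d) : L g = ∑ i ∈ Finset.range (d + 1), g.coeff i * L (X ^ i) := by
  conv_lhs => rw [g.as_sum_range_C_mul_X_pow' (Nat.lt_succ_of_le hd)]
  simp only [map_sum, map_C_mul]

theorem intervalIntegrable_eval_mul {φ : ℝ → ℝ} (hφ : IntervalIntegrable φ volume 0 1) (g : ℝ[X]) :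
    IntervalIntegrable (fun x => g.eval x * φ x) volume 0 1 :=
  hφ.continuousOn_mul g.continuous.continuousOn

theorem momentFunctional_apply {φ : ℝ → ℝ} (hφ : IntervalIntegrable φ volume 0 1) (g : ℝ[X]) :
    momentFunctional φ g = ∫ x in (0 : ℝ)..1, g.eval x * φ x := by
  rw [map_eq_sum_of_natDegree_le _ le_rfl]
  simp_rw [eval_eq_sum_range, Finset.sum_mul, mul_assoc]
  rw [intervalIntegral.integral_finsetSum fun i _ =>
    (hφ.continuousOn_mul (continuous_pow i).continuousOn).const_mul _]
  simp only [momentFunctional_X_pow, intervalIntegral.integral_const_mul]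

theorem momentFunctional_X_mul {φ ψ : ℝ → ℝ} (h : ∀ x ∈ Ioo (0 : ℝ) 1, x * φ x = ψ x) (g : ℝ[X]) :
    momentFunctional φ (X * g) = momentFunctional ψ g := by
  have hd : (X * g).natDegree ≤ g.natDegree + 1 :=
    natDegree_mul_le.trans (by rw [add_comm]; gcongr; exact natDegree_X_le)
  rw [map_eq_sum_of_natDegree_le _ hd, map_eq_sum_of_natDegree_le _ le_rfl, Finset.sum_range_succ',
    coeff_X_mul_zero, zero_mul, add_zero]
  refine Finset.sum_congr rfl fun i _ => ?_
  rw [coeff_X_mul, momentFunctional_X_pow, momentFunctional_X_pow]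
  refine congrArg _ (intervalIntegral.integral_congr_Ioo_of_le zero_le_one fun x hx => ?_)
  simp only [← h x hx, pow_succ, mul_assoc]

theorem momentFunctional_mul_self_pos {φ : ℝ → ℝ} (hφ : IntervalIntegrable φ volume 0 1)
    (hpos : ∀ x ∈ Ioo (0 : ℝ) 1, 0 < φ x) {g : ℝ[X]} (hg : g ≠ 0) :
    0 < momentFunctional φ (g * g) := by
  have hnn : 0 ≤ᵐ[volume.restrict (uIoc (0 : ℝ) 1)] fun x => (g * g).eval x * φ x := by
    rw [uIoc_of_le zero_le_one, ← restrict_Ioo_eq_restrict_Ioc]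
    refine ae_restrict_of_forall_mem measurableSet_Ioo fun x hx => ?_
    simp only [Pi.zero_apply, eval_mul]
    exact mul_nonneg (mul_self_nonneg _) (hpos x hx).le
  have hsub : Ioo (0 : ℝ) 1 \ ↑g.roots.toFinset ⊆
      Function.support (fun x => (g * g).eval x * φ x) ∩ Ioc 0 1 := by
    rintro x ⟨hx, hroot⟩
    have hgx : g.eval x ≠ 0 := fun h => hroot (by simp [hg, h])
    refine ⟨?_, hx.1, hx.2.le⟩
    rw [Function.mem_support, eval_mul]
    exact mul_ne_zero (mul_ne_zero hgx hgx) (hpos x hx).ne'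
  rw [momentFunctional_apply hφ, intervalIntegral.integral_pos_iff_support_of_nonneg_ae' hnn
    (intervalIntegrable_eval_mul hφ _)]
  refine ⟨zero_lt_one, lt_of_lt_of_le ?_ (measure_mono hsub)⟩
  rw [measure_sdiff_null (Finset.measure_zero _ _), Real.volume_Ioo]
  simp

theorem intervalIntegrable_of_nonneg_of_le {φ ψ : ℝ → ℝ} {a b : ℝ} (hab : a ≤ b)
    (hψ : IntervalIntegrable ψ volume a b) (hφ : Measurable φ) (hnn : ∀ x ∈ Ioo a b, 0 ≤ φ x)
    (hle : ∀ x ∈ Ioo a b, φ x ≤ ψ x) : IntervalIntegrable φ volume a b := by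
  refine hψ.mono_fun' hφ.aestronglyMeasurable ?_
  rw [uIoc_of_le hab, ← restrict_Ioo_eq_restrict_Ioc]
  refine ae_restrict_of_forall_mem measurableSet_Ioo fun x hx => ?_
  exact (Real.norm_of_nonneg (hnn x hx)).trans_le (hle x hx)

section Weight

variable {α β t x : ℝ}

theorem weight_pos (α β t : ℝ) (hx : x ∈ Ioo (0 : ℝ) 1) : 0 < weight α β t x :=
  mul_pos (mul_pos (Real.rpow_pos_of_pos hx.1 _) (Real.rpow_pos_of_pos (sub_pos.2 hx.2) _))
    (Real.exp_pos _)

@[fun_prop]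
theorem measurable_weight (α β t : ℝ) : Measurable (weight α β t) := by
  unfold weight
  fun_prop

theorem continuous_weight_param (α β x : ℝ) : Continuous fun t => weight α β t x := by
  unfold weight
  fun_prop

theorem abs_weight_le (α β : ℝ) (ht : 0 ≤ t) (hx : 0 ≤ x) :
    |weight α β t x| ≤ |weight α β 0 x| := by
  have hexp : Real.exp (-t / x) ≤ 1 :=
    Real.exp_le_one_iff.2 (div_nonpos_of_nonpos_of_nonneg (neg_nonpos.2 ht) hx)
  rw [weight, weight, neg_zero, zero_div, Real.exp_zero, mul_one, abs_mul, Real.abs_exp]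
  exact mul_le_of_le_one_right (abs_nonneg _) hexp

theorem weight_le_of_mem_Ioo (α β : ℝ) (ht : 0 ≤ t) (hx : x ∈ Ioo (0 : ℝ) 1) :
    weight α β t x ≤ x ^ α * (1 - x) ^ β := by
  have h := abs_weight_le α β ht hx.1.le
  rw [abs_of_pos (weight_pos α β t hx), abs_of_pos (weight_pos α β 0 hx)] at h
  simpa [weight] using h

theorem weight_le_rpow (hβ : 0 ≤ β) (ht : 0 ≤ t) (hx : x ∈ Ioo (0 : ℝ) 1) :
    weight α β t x ≤ x ^ α := by
  have h₁ : (1 - x) ^ β ≤ 1 :=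
    Real.rpow_le_one (sub_pos.2 hx.2).le (sub_le_self _ hx.1.le) hβ
  exact (weight_le_of_mem_Ioo α β ht hx).trans <|
    mul_le_of_le_one_right (Real.rpow_nonneg hx.1.le _) h₁

theorem weight_le_one_sub_rpow (hα : 0 ≤ α) (ht : 0 ≤ t) (hx : x ∈ Ioo (0 : ℝ) 1) :
    weight α β t x ≤ (1 - x) ^ β := by
  have h₁ : x ^ α ≤ 1 := Real.rpow_le_one hx.1.le hx.2.le hα
  exact (weight_le_of_mem_Ioo α β ht hx).trans <|
    mul_le_of_le_one_left (Real.rpow_nonneg (sub_pos.2 hx.2).le _) h₁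

theorem weight_le_mul_pow (hα : 0 ≤ α) (hβ : 0 ≤ β) (ht : 0 < t) (hx : x ∈ Ioo (0 : ℝ) 1) (k : ℕ) :
    weight α β t x ≤ k.factorial / t ^ k * x ^ k := by
  have hx₀ := hx.1
  have h₁ : x ^ α ≤ 1 := Real.rpow_le_one hx.1.le hx.2.le hα
  have h₂ : (1 - x) ^ β ≤ 1 :=
    Real.rpow_le_one (sub_pos.2 hx.2).le (sub_le_self _ hx.1.le) hβ
  have hexp : Real.exp (-t / x) ≤ k.factorial / t ^ k * x ^ k := by
    rw [neg_div, Real.exp_neg, inv_le_comm₀ (Real.exp_pos _) (by positivity)]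
    refine le_of_eq_of_le ?_ (Real.pow_div_factorial_le_exp (t / x) (by positivity) k)
    rw [div_pow]
    field_simp
  calc weight α β t x ≤ 1 * Real.exp (-t / x) := by
        refine mul_le_mul_of_nonneg_right ?_ (Real.exp_pos _).le
        exact mul_le_one₀ h₁ (Real.rpow_nonneg (sub_pos.2 hx.2).le _) h₂
    _ ≤ k.factorial / t ^ k * x ^ k := by rwa [one_mul]

theorem intervalIntegrable_weight (hα : 0 ≤ α) (hβ : 0 ≤ β) (ht : 0 ≤ t) :
    IntervalIntegrable (weight α β t) volume 0 1 :=
  intervalIntegrable_of_nonneg_of_le zero_le_one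
    (intervalIntegral.intervalIntegrable_rpow' (r := α) (by linarith)) (by fun_prop)
    (fun _ hx => (weight_pos α β t hx).le) fun _ hx => weight_le_rpow hβ ht hx

theorem intervalIntegrable_weight_div (hα : 0 < α) (hβ : 0 ≤ β) (ht : 0 ≤ t) :
    IntervalIntegrable (fun x => weight α β t x / x) volume 0 1 := by
  refine intervalIntegrable_of_nonneg_of_le zero_le_one
    (intervalIntegral.intervalIntegrable_rpow' (r := α - 1) (by linarith)) (by fun_prop)
    (fun x hx => div_nonneg (weight_pos α β t hx).le hx.1.le) fun x hx => ?_
  rw [Real.rpow_sub_one hx.1.ne']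
  exact div_le_div_of_nonneg_right (weight_le_rpow hβ ht hx) hx.1.le

theorem intervalIntegrable_weight_div_pow (hα : 0 ≤ α) (hβ : 0 ≤ β) (ht : 0 < t) (k : ℕ) :
    IntervalIntegrable (fun x => weight α β t x / x ^ k) volume 0 1 :=
  intervalIntegrable_of_nonneg_of_le zero_le_one (ψ := fun _ => k.factorial / t ^ k) (by simp)
    (by fun_prop) (fun x hx => div_nonneg (weight_pos α β t hx).le (pow_pos hx.1 k).le)
    fun _ hx => (div_le_iff₀ (pow_pos hx.1 k)).2 (weight_le_mul_pow hα hβ ht hx k)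

theorem intervalIntegrable_weight_div_sub_one (hα : 0 ≤ α) (hβ : 0 < β) (ht : 0 ≤ t) :
    IntervalIntegrable (fun x => weight α β t x / (x - 1)) volume 0 1 := by
  have hψ : IntervalIntegrable (fun x : ℝ => (1 - x) ^ (β - 1)) volume 0 1 := by
    simpa using ((intervalIntegral.intervalIntegrable_rpow' (a := 0) (b := 1)
      (r := β - 1) (by linarith)).comp_sub_left 1).symm
  have hneg : IntervalIntegrable (fun x => weight α β t x / (1 - x)) volume 0 1 := by
    refine intervalIntegrable_of_nonneg_of_le zero_le_one hψ (by fun_prop)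
      (fun x hx => div_nonneg (weight_pos α β t hx).le (sub_pos.2 hx.2).le) fun x hx => ?_
    rw [Real.rpow_sub_one (sub_pos.2 hx.2).ne']
    exact div_le_div_of_nonneg_right (weight_le_one_sub_rpow hα ht hx) (sub_pos.2 hx.2).le
  refine hneg.neg.congr fun x _ => ?_
  rw [Pi.neg_apply, ← div_neg, neg_sub]

theorem tendsto_weight_zero (hα : 0 < α) (hβ : 0 ≤ β) (ht : 0 ≤ t) :
    Tendsto (weight α β t) (𝓝[>] 0) (𝓝 0) := by
  have hrpow : Tendsto (fun x : ℝ => x ^ α) (𝓝[>] 0) (𝓝 0) := by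
    simpa [Real.zero_rpow hα.ne'] using
      ((Real.continuousAt_rpow_const 0 α (Or.inr hα.le)).tendsto).mono_left nhdsWithin_le_nhds
  have hmem : ∀ᶠ x : ℝ in 𝓝[>] 0, x ∈ Ioo (0 : ℝ) 1 := Ioo_mem_nhdsGT zero_lt_one
  exact squeeze_zero' (hmem.mono fun _ hx => (weight_pos α β t hx).le)
    (hmem.mono fun _ hx => weight_le_rpow hβ ht hx) hrpow

theorem tendsto_weight_one (hα : 0 ≤ α) (hβ : 0 < β) (ht : 0 ≤ t) :
    Tendsto (weight α β t) (𝓝[<] 1) (𝓝 0) := by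
  have hrpow : Tendsto (fun x : ℝ => (1 - x) ^ β) (𝓝[<] 1) (𝓝 0) := by
    have h : ContinuousAt (fun x : ℝ => (1 - x) ^ β) 1 :=
      (continuousAt_const.sub continuousAt_id).rpow_const (Or.inr hβ.le)
    simpa [Real.zero_rpow hβ.ne'] using h.tendsto.mono_left nhdsWithin_le_nhds
  have hmem : ∀ᶠ x : ℝ in 𝓝[<] 1, x ∈ Ioo (0 : ℝ) 1 := Ioo_mem_nhdsLT zero_lt_one
  exact squeeze_zero' (hmem.mono fun _ hx => (weight_pos α β t hx).le)
    (hmem.mono fun _ hx => weight_le_one_sub_rpow hα ht hx) hrpow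

theorem hasDerivAt_weight (α β t : ℝ) (hx : x ∈ Ioo (0 : ℝ) 1) :
    HasDerivAt (weight α β t) ((α / x + β / (x - 1) + t / x ^ 2) * weight α β t x) x := by
  have hx₀ : 0 < x := hx.1
  have hx₁ : 0 < 1 - x := sub_pos.2 hx.2
  have hx₁' : x - 1 ≠ 0 := (sub_neg.2 hx.2).ne
  have dα := (hasDerivAt_id x).rpow_const (p := α) (Or.inl hx₀.ne')
  have dβ := ((hasDerivAt_id x).const_sub 1).rpow_const (p := β) (Or.inl hx₁.ne')
  have dexp := ((hasDerivAt_inv hx₀.ne').const_mul (-t)).exp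
  refine ((dα.mul dβ).mul dexp).congr_deriv ?_
  simp only [weight, Pi.mul_apply, id, Real.rpow_sub_one hx₀.ne', Real.rpow_sub_one hx₁.ne',
    div_eq_mul_inv]
  field_simp
  ring

theorem hasDerivAt_weight_param (α β t x : ℝ) :
    HasDerivAt (fun s => weight α β s x) (-(weight α β t x / x)) t := by
  refine (((hasDerivAt_id t).neg.div_const x).exp.const_mul (x ^ α * (1 - x) ^ β)).congr_deriv ?_
  simp only [weight, id, Pi.neg_apply]
  ring

end Weight

theorem const_mul_momentFunctional (c : ℝ) (φ : ℝ → ℝ) (g : ℝ[X]) :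
    c * momentFunctional φ g = momentFunctional (fun x => c * φ x) g := by
  rw [map_eq_sum_of_natDegree_le (momentFunctional φ) le_rfl,
    map_eq_sum_of_natDegree_le _ le_rfl, Finset.mul_sum]
  refine Finset.sum_congr rfl fun i _ => ?_
  rw [momentFunctional_X_pow, momentFunctional_X_pow, mul_left_comm,
    ← intervalIntegral.integral_const_mul]
  simp only [mul_left_comm c]

section Weight

variable {α β t : ℝ}

theorem intervalIntegrable_const_mul_weight_div_sq (hα : 0 ≤ α) (hβ : 0 ≤ β) (ht : 0 ≤ t) :
    IntervalIntegrable (fun x => t * (weight α β t x / x ^ 2)) volume 0 1 := by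
  rcases ht.eq_or_lt with rfl | ht
  · simp
  · exact (intervalIntegrable_weight_div_pow hα hβ ht 2).const_mul t

theorem momentFunctional_weight_pearson (hα : 0 < α) (hβ : 0 < β) (ht : 0 ≤ t) (g : ℝ[X]) :
    momentFunctional (weight α β t) (derivative g) +
      α * momentFunctional (fun x => weight α β t x / x) g +
      β * momentFunctional (fun x => weight α β t x / (x - 1)) g +
      t * momentFunctional (fun x => weight α β t x / x ^ 2) g = 0 := by
  have hw := intervalIntegrable_weight hα.le hβ.le ht
  have hwα := (intervalIntegrable_weight_div hα hβ.le ht).const_mul α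
  have hwβ := (intervalIntegrable_weight_div_sub_one hα.le hβ ht).const_mul β
  have hwt := intervalIntegrable_const_mul_weight_div_sq hα.le hβ.le ht
  have hi₀ := intervalIntegrable_eval_mul hw (derivative g)
  have hi₁ := hi₀.add (intervalIntegrable_eval_mul hwα g)
  have hi₂ := hi₁.add (intervalIntegrable_eval_mul hwβ g)
  have hi₃ := intervalIntegrable_eval_mul hwt g
  rw [const_mul_momentFunctional, const_mul_momentFunctional, const_mul_momentFunctional,
    momentFunctional_apply hw, momentFunctional_apply hwα, momentFunctional_apply hwβ,
    momentFunctional_apply hwt, ← intervalIntegral.integral_add hi₀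
      (intervalIntegrable_eval_mul hwα g), ← intervalIntegral.integral_add hi₁
      (intervalIntegrable_eval_mul hwβ g), ← intervalIntegral.integral_add hi₂ hi₃]
  have h₀ := g.continuous.continuousAt.tendsto.mono_left nhdsWithin_le_nhds |>.mul
    (tendsto_weight_zero hα hβ.le ht)
  have h₁ := g.continuous.continuousAt.tendsto.mono_left nhdsWithin_le_nhds |>.mul
    (tendsto_weight_one hα.le hβ ht)
  rw [intervalIntegral.integral_eq_sub_of_hasDerivAt_of_tendsto zero_lt_one (fun x hx => ?_)
    (hi₂.add hi₃) h₀ h₁, mul_zero, mul_zero, sub_zero]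
  exact ((g.hasDerivAt x).mul (hasDerivAt_weight α β t hx)).congr_deriv (by ring)

theorem hasDerivAt_momentFunctional_weight (hα : 0 < α) (hβ : 0 ≤ β) (ht : 0 < t) (g : ℝ[X]) :
    HasDerivAt (fun s => momentFunctional (weight α β s) g)
      (-momentFunctional (fun x => weight α β t x / x) g) t := by
  have hwt := intervalIntegrable_weight hα.le hβ ht.le
  have hwt₁ := intervalIntegrable_weight_div hα hβ ht.le
  have hw₀ := intervalIntegrable_weight_div hα hβ le_rfl
  have key := (intervalIntegral.hasDerivAt_integral_of_dominated_loc_of_deriv_le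
    (F := fun s x => g.eval x * weight α β s x)
    (F' := fun s x => -(g.eval x * (weight α β s x / x)))
    (bound := fun x => |g.eval x * (weight α β 0 x / x)|)
    (Ioi_mem_nhds ht)
    (.of_forall fun s =>
      (g.continuous.measurable.mul (measurable_weight α β s)).aestronglyMeasurable)
    (intervalIntegrable_eval_mul hwt g)
    (g.continuous.measurable.mul
      ((measurable_weight α β t).div measurable_id)).neg.aestronglyMeasurable
    ?_ (intervalIntegrable_eval_mul hw₀ g).abs ?_).2
  · rw [momentFunctional_apply hwt₁, ← intervalIntegral.integral_neg]
    refine key.congr_of_eventuallyEq ?_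
    filter_upwards [Ioi_mem_nhds ht] with s hs
    exact momentFunctional_apply (intervalIntegrable_weight hα.le hβ (le_of_lt hs)) g
  · refine .of_forall fun x hx s hs => ?_
    rw [uIoc_of_le zero_le_one] at hx
    rw [norm_neg, Real.norm_eq_abs, abs_mul, abs_mul, abs_div, abs_div]
    exact mul_le_mul_of_nonneg_left (div_le_div_of_nonneg_right
      (abs_weight_le α β (le_of_lt hs) hx.1.le) (abs_nonneg x)) (abs_nonneg _)
  · refine .of_forall fun x _ s _ => ?_
    exact ((hasDerivAt_weight_param α β s x).const_mul (g.eval x)).congr_deriv (by ring)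

theorem continuousOn_momentFunctional_weight (hα : 0 ≤ α) (hβ : 0 ≤ β) (g : ℝ[X]) :
    ContinuousOn (fun s => momentFunctional (weight α β s) g) (Ici 0) := by
  have hw₀ := intervalIntegrable_weight hα hβ le_rfl
  refine ContinuousOn.congr (fun t _ => ?_)
    fun s hs => momentFunctional_apply (intervalIntegrable_weight hα hβ hs) g
  refine intervalIntegral.continuousWithinAt_of_dominated_interval
    (bound := fun x => |g.eval x * weight α β 0 x|) (.of_forall fun s =>
      (g.continuous.measurable.mul (measurable_weight α β s)).aestronglyMeasurable) ?_
    (intervalIntegrable_eval_mul hw₀ g).abs (.of_forall fun x _ =>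
      ((continuous_weight_param α β x).const_mul (g.eval x)).continuousWithinAt)
  filter_upwards [self_mem_nhdsWithin] with s hs
  refine .of_forall fun x hx => ?_
  rw [uIoc_of_le zero_le_one] at hx
  rw [Real.norm_eq_abs, abs_mul, abs_mul]
  exact mul_le_mul_of_nonneg_left (abs_weight_le α β hs hx.1.le) (abs_nonneg _)

end Weight

section OrthoPoly

variable {α β t : ℝ}

theorem ip_eq_momentFunctional (hα : 0 ≤ α) (hβ : 0 ≤ β) (ht : 0 ≤ t) (p q : ℝ[X]) :
    ip α β t p q = momentFunctional (weight α β t) (p * q) := by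
  rw [momentFunctional_apply (intervalIntegrable_weight hα hβ ht)]
  simp only [ip, eval_mul]

theorem orthoPoly_eq (α β t : ℝ) (n : ℕ) : orthoPoly α β t n = X ^ n - ∑ j ∈ Finset.range n,
    C (ip α β t (X ^ n) (orthoPoly α β t j) / normSq j α β t) * orthoPoly α β t j := by
  rw [orthoPoly, Finset.sum_range]
  rfl

theorem monic_orthoPoly_and_natDegree_eq (α β t : ℝ) (n : ℕ) :
    (orthoPoly α β t n).Monic ∧ (orthoPoly α β t n).natDegree = n := by
  induction n using Nat.strong_induction_on with
  | _ n ih =>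
    have hdeg : (∑ j ∈ Finset.range n, C (ip α β t (X ^ n) (orthoPoly α β t j) /
        normSq j α β t) * orthoPoly α β t j).degree < n := by
      refine mem_degreeLT.1 <| Submodule.sum_mem _ fun j hj => ?_
      have hj := Finset.mem_range.1 hj
      rw [← smul_eq_C_mul]
      refine Submodule.smul_mem _ _ (mem_degreeLT.2 ?_)
      rw [degree_eq_natDegree (ih j hj).1.ne_zero, (ih j hj).2]
      exact_mod_cast hj
    rw [orthoPoly_eq]
    refine ⟨monic_X_pow_sub hdeg, natDegree_eq_of_degree_eq_some ?_⟩
    rw [degree_sub_eq_left_of_degree_lt (by rwa [degree_X_pow]), degree_X_pow]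

theorem normSq_eq (hα : 0 ≤ α) (hβ : 0 ≤ β) (ht : 0 ≤ t) (n : ℕ) : normSq n α β t =
    momentFunctional (weight α β t) (orthoPoly α β t n * orthoPoly α β t n) :=
  ip_eq_momentFunctional hα hβ ht _ _

theorem normSq_pos (hα : 0 ≤ α) (hβ : 0 ≤ β) (ht : 0 ≤ t) (n : ℕ) : 0 < normSq n α β t := by
  rw [normSq_eq hα hβ ht]
  exact momentFunctional_mul_self_pos (intervalIntegrable_weight hα hβ ht)
    (fun _ hx => weight_pos α β t hx) (monic_orthoPoly_and_natDegree_eq α β t n).1.ne_zero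

theorem momentFunctional_orthoPoly_mul_of_lt (hα : 0 ≤ α) (hβ : 0 ≤ β) (ht : 0 ≤ t) {j n : ℕ}
    (hj : j < n) : momentFunctional (weight α β t) (orthoPoly α β t n * orthoPoly α β t j) = 0 := by
  induction n using Nat.strong_induction_on generalizing j with
  | _ n ih =>
    have hz : ∀ i ∈ Finset.range n, i ≠ j →
        momentFunctional (weight α β t) (orthoPoly α β t i * orthoPoly α β t j) = 0 := by
      intro i hi hij
      rcases lt_or_gt_of_ne hij with h | h
      · rw [mul_comm]; exact ih j hj h
      · exact ih i (Finset.mem_range.1 hi) h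
    rw [orthoPoly_eq α β t n, sub_mul, map_sub, Finset.sum_mul, map_sum,
      Finset.sum_eq_single_of_mem j (Finset.mem_range.2 hj)]
    · rw [mul_assoc, map_C_mul, ip_eq_momentFunctional hα hβ ht, ← normSq_eq hα hβ ht,
        div_mul_cancel₀ _ (normSq_pos hα hβ ht j).ne', sub_self]
    · intro i hi hij
      rw [mul_assoc, map_C_mul, hz i hi hij, mul_zero]

theorem isMonicOrthogonal_orthoPoly (hα : 0 ≤ α) (hβ : 0 ≤ β) (ht : 0 ≤ t) :
    IsMonicOrthogonal (momentFunctional (weight α β t)) (orthoPoly α β t) where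
  monic n := (monic_orthoPoly_and_natDegree_eq α β t n).1
  natDegree_eq n := (monic_orthoPoly_and_natDegree_eq α β t n).2
  orthogonal h := momentFunctional_orthoPoly_mul_of_lt hα hβ ht h

theorem hankelDet_eq_prod (hα : 0 ≤ α) (hβ : 0 ≤ β) (ht : 0 ≤ t) (n : ℕ) :
    hankelDet n α β t = ∏ j ∈ Finset.range n, normSq j α β t := by
  simp only [hankelDet, ← momentFunctional_X_pow, normSq_eq hα hβ ht]
  exact (isMonicOrthogonal_orthoPoly hα hβ ht).det_hankel n

theorem hankelDet_pos (hα : 0 ≤ α) (hβ : 0 ≤ β) (ht : 0 ≤ t) (n : ℕ) :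
    0 < hankelDet n α β t := by
  rw [hankelDet_eq_prod hα hβ ht]
  exact Finset.prod_pos fun j _ => normSq_pos hα hβ ht j

theorem momentFunctional_X_sub_C_mul (hα : 0 ≤ α) (hβ : 0 < β) (ht : 0 ≤ t) (g : ℝ[X]) :
    momentFunctional (fun x => weight α β t x / (x - 1)) ((X - C 1) * g) =
      momentFunctional (weight α β t) g := by
  rw [momentFunctional_apply (intervalIntegrable_weight_div_sub_one hα hβ ht),
    momentFunctional_apply (intervalIntegrable_weight hα hβ.le ht)]
  refine intervalIntegral.integral_congr_Ioo_of_le zero_le_one fun x hx => ?_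
  have hx₁ : x - 1 ≠ 0 := (sub_neg.2 hx.2).ne
  simp only [eval_mul, eval_sub, eval_X, eval_C]
  field_simp

/-- The Pearson system of the Pollaczek-Jacobi weight. -/
def pearsonSystem (hα : 0 < α) (hβ : 0 < β) (ht : 0 ≤ t) : PearsonSystem ℝ where
  α := α
  β := β
  t := t
  L := momentFunctional (weight α β t)
  L₁ := momentFunctional fun x => weight α β t x / x
  L₂ := momentFunctional fun x => weight α β t x / x ^ 2
  V := momentFunctional fun x => weight α β t x / (x - 1)
  P := orthoPoly α β t
  isMonicOrthogonal := isMonicOrthogonal_orthoPoly hα.le hβ.le ht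
  map_mul_self_ne_zero n := (normSq_eq hα.le hβ.le ht n ▸ normSq_pos hα.le hβ.le ht n).ne'
  L₁_X_mul := momentFunctional_X_mul fun _ hx => mul_div_cancel₀ _ hx.1.ne'
  L₂_X_mul := momentFunctional_X_mul fun x hx => by have := hx.1.ne'; field_simp
  V_X_sub_C_mul := momentFunctional_X_sub_C_mul hα.le hβ ht
  pearson := momentFunctional_weight_pearson hα hβ ht

variable (hα : 0 < α) (hβ : 0 < β) (ht : 0 ≤ t) (n : ℕ)

theorem normSq_eq_h : normSq n α β t = (pearsonSystem hα hβ ht).h n :=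
  normSq_eq hα.le hβ.le ht n

theorem RFun_eq_R : RFun n α β t = (pearsonSystem hα hβ ht).R n := by
  have hV : (pearsonSystem hα hβ ht).V (orthoPoly α β t n * orthoPoly α β t n) =
      -∫ x in (0 : ℝ)..1, (orthoPoly α β t n).eval x ^ 2 * weight α β t x / (1 - x) := by
    refine (momentFunctional_apply (intervalIntegrable_weight_div_sub_one hα.le hβ ht) _).trans ?_
    rw [← intervalIntegral.integral_neg]
    congr 1 with x
    rw [← div_neg, neg_sub, eval_mul]
    ring
  rw [RFun, normSq_eq_h hα hβ ht, PearsonSystem.R,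
    show (pearsonSystem hα hβ ht).P = orthoPoly α β t from rfl, hV]
  change β / _ * _ = -(β * _) / _
  ring

theorem rStar_eq_rStar : rStar (n + 1) α β t = (pearsonSystem hα hβ ht).rStar n := by
  have hL₁ : (pearsonSystem hα hβ ht).L₁ (orthoPoly α β t (n + 1) * orthoPoly α β t n) =
      ∫ x in (0 : ℝ)..1, (orthoPoly α β t (n + 1)).eval x * (orthoPoly α β t n).eval x *
        weight α β t x / x := by
    refine (momentFunctional_apply (intervalIntegrable_weight_div hα hβ.le ht) _).trans ?_
    simp only [eval_mul, mul_div_assoc]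
  rw [rStar, Nat.add_sub_cancel, normSq_eq_h hα hβ ht, ← hL₁, PearsonSystem.rStar,
    div_mul_eq_mul_div]
  rfl

end OrthoPoly

section Parameter

theorem diffContOnCl_finsetSum {ι E : Type*} [NormedAddCommGroup E] [NormedSpace ℝ E] {U : Set E}
    {f : ι → E → ℝ} (u : Finset ι) (h : ∀ i ∈ u, DiffContOnCl ℝ (f i) U) :
    DiffContOnCl ℝ (fun x => ∑ i ∈ u, f i x) U :=
  ⟨.fun_sum fun i hi => (h i hi).differentiableOn,
    continuousOn_finsetSum u fun i hi => (h i hi).continuousOn⟩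

theorem diffContOnCl_congr {E : Type*} [NormedAddCommGroup E] [NormedSpace ℝ E] {U : Set E}
    {f g : E → ℝ} (hf : DiffContOnCl ℝ f U) (h : EqOn g f (closure U)) : DiffContOnCl ℝ g U :=
  ⟨hf.differentiableOn.congr (h.mono subset_closure), hf.continuousOn.congr h⟩

theorem diffContOnCl_coeff_mul {E : Type*} [NormedAddCommGroup E] [NormedSpace ℝ E] {U : Set E}
    {P Q : E → ℝ[X]} (hP : ∀ k, DiffContOnCl ℝ (fun x => (P x).coeff k) U)
    (hQ : ∀ k, DiffContOnCl ℝ (fun x => (Q x).coeff k) U) (k : ℕ) :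
    DiffContOnCl ℝ (fun x => (P x * Q x).coeff k) U := by
  simp only [coeff_mul]
  exact diffContOnCl_finsetSum _ fun i _ => (hP i.1).smul (hQ i.2)

/-- The polynomial `D` is the coefficientwise derivative at `t` of the family `P`. -/
def HasCoeffDerivAt (P : ℝ → ℝ[X]) (D : ℝ[X]) (t : ℝ) : Prop :=
  ∀ k, HasDerivAt (fun s => (P s).coeff k) (D.coeff k) t

theorem HasCoeffDerivAt.mul {P Q : ℝ → ℝ[X]} {D E : ℝ[X]} {t : ℝ} (hP : HasCoeffDerivAt P D t)
    (hQ : HasCoeffDerivAt Q E t) :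
    HasCoeffDerivAt (fun s => P s * Q s) (D * Q t + P t * E) t := fun k => by
  simp only [coeff_add, coeff_mul, ← Finset.sum_add_distrib]
  exact .fun_sum fun i _ => (hP i.1).mul (hQ i.2)

variable {α β t : ℝ}

theorem diffContOnCl_momentFunctional_weight (hα : 0 < α) (hβ : 0 ≤ β) {Q : ℝ → ℝ[X]} {d : ℕ}
    (hd : ∀ s, (Q s).natDegree ≤ d) (hQ : ∀ k, DiffContOnCl ℝ (fun s => (Q s).coeff k) (Ioi 0)) :
    DiffContOnCl ℝ (fun s => momentFunctional (weight α β s) (Q s)) (Ioi 0) := by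
  simp only [fun s => map_eq_sum_of_natDegree_le (momentFunctional (weight α β s)) (hd s)]
  refine diffContOnCl_finsetSum _ fun i _ => (hQ i).smul ⟨fun s hs => ?_, ?_⟩
  · exact (hasDerivAt_momentFunctional_weight hα hβ hs _).differentiableAt.differentiableWithinAt
  · rw [closure_Ioi]
    exact continuousOn_momentFunctional_weight hα.le hβ _

theorem hasDerivAt_momentFunctional_weight_family (hα : 0 < α) (hβ : 0 ≤ β) (ht : 0 < t)
    {Q : ℝ → ℝ[X]} {D : ℝ[X]} {d : ℕ} (hd : ∀ s, (Q s).natDegree ≤ d) (hD : D.natDegree ≤ d)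
    (hQ : HasCoeffDerivAt Q D t) :
    HasDerivAt (fun s => momentFunctional (weight α β s) (Q s))
      (momentFunctional (weight α β t) D -
        momentFunctional (fun x => weight α β t x / x) (Q t)) t := by
  simp only [fun φ s => map_eq_sum_of_natDegree_le (momentFunctional φ) (hd s),
    fun φ => map_eq_sum_of_natDegree_le (momentFunctional φ) hD, ← Finset.sum_sub_distrib]
  refine .fun_sum fun i _ => ?_
  exact ((hQ i).mul (hasDerivAt_momentFunctional_weight hα hβ ht (X ^ i))).congr_deriv (by ring)

theorem natDegree_orthoPoly (α β t : ℝ) (n : ℕ) : (orthoPoly α β t n).natDegree = n :=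
  (monic_orthoPoly_and_natDegree_eq α β t n).2

theorem natDegree_orthoPoly_mul_le (α β t : ℝ) (m n : ℕ) :
    (orthoPoly α β t m * orthoPoly α β t n).natDegree ≤ m + n :=
  natDegree_mul_le.trans (by rw [natDegree_orthoPoly, natDegree_orthoPoly])

theorem diffContOnCl_normSq_of_coeff (hα : 0 < α) (hβ : 0 ≤ β) {n : ℕ}
    (hP : ∀ k, DiffContOnCl ℝ (fun s => (orthoPoly α β s n).coeff k) (Ioi 0)) :
    DiffContOnCl ℝ (normSq n α β) (Ioi 0) :=
  diffContOnCl_congr (diffContOnCl_momentFunctional_weight hα hβ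
    (fun s => natDegree_orthoPoly_mul_le α β s n n) (diffContOnCl_coeff_mul hP hP))
    fun s hs => normSq_eq hα.le hβ (by rwa [closure_Ioi] at hs) n

theorem diffContOnCl_coeff_orthoPoly (hα : 0 < α) (hβ : 0 ≤ β) (n k : ℕ) :
    DiffContOnCl ℝ (fun s => (orthoPoly α β s n).coeff k) (Ioi 0) := by
  induction n using Nat.strong_induction_on generalizing k with
  | _ n ih =>
    simp only [fun s => orthoPoly_eq α β s n, coeff_sub, finsetSum_coeff, coeff_C_mul]
    refine diffContOnCl_const.sub <| diffContOnCl_finsetSum _ fun j hj => ?_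
    have hP := ih j (Finset.mem_range.1 hj)
    have hnum : DiffContOnCl ℝ (fun s => ip α β s (X ^ n) (orthoPoly α β s j)) (Ioi 0) := by
      refine diffContOnCl_congr (diffContOnCl_momentFunctional_weight hα hβ (d := n + j)
        (Q := fun s => X ^ n * orthoPoly α β s j) (fun s => ?_)
        (diffContOnCl_coeff_mul (fun _ => diffContOnCl_const) hP)) fun s hs => ?_
      · exact natDegree_mul_le.trans (by rw [natDegree_X_pow, natDegree_orthoPoly])
      · exact ip_eq_momentFunctional hα.le hβ (by rwa [closure_Ioi] at hs) _ _
    refine (hnum.smul ((diffContOnCl_normSq_of_coeff hα hβ hP).inv fun s hs => ?_)).smul (hP k)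
    exact (normSq_pos hα.le hβ (by rwa [closure_Ioi] at hs) j).ne'

theorem exists_hasCoeffDerivAt_orthoPoly (hα : 0 < α) (hβ : 0 ≤ β) (ht : 0 < t) (n : ℕ) :
    ∃ D : ℝ[X], D.degree < n ∧ HasCoeffDerivAt (fun s => orthoPoly α β s n) D t := by
  set c : ℕ → ℝ := fun k => deriv (fun s => (orthoPoly α β s n).coeff k) t
  have hc (k : ℕ) : HasDerivAt (fun s => (orthoPoly α β s n).coeff k) (c k) t :=
    ((diffContOnCl_coeff_orthoPoly hα hβ n k).differentiableAt isOpen_Ioi ht).hasDerivAt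
  have hc₀ (k : ℕ) (hk : n ≤ k) : c k = 0 := by
    have hconst (s : ℝ) : (orthoPoly α β s n).coeff k = if k = n then 1 else 0 := by
      split_ifs with h
      · rw [h]
        simpa only [natDegree_orthoPoly] using
          (monic_orthoPoly_and_natDegree_eq α β s n).1.coeff_natDegree
      · exact coeff_eq_zero_of_natDegree_lt (by rw [natDegree_orthoPoly]; lia)
    simp only [c, hconst, deriv_const]
  have hcoeff (k : ℕ) : (∑ i ∈ Finset.range n, monomial i (c i)).coeff k = c k := by
    simp only [finsetSum_coeff, coeff_monomial, Finset.sum_ite_eq', Finset.mem_range]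
    exact ite_eq_left_iff.2 fun h => (hc₀ k (not_lt.1 h)).symm
  refine ⟨∑ i ∈ Finset.range n, monomial i (c i), ?_, fun k => (hcoeff k).symm ▸ hc k⟩
  exact (degree_lt_iff_coeff_zero _ _).2 fun k hk => (hcoeff k).trans (hc₀ k hk)

theorem hasDerivAt_momentFunctional_orthoPoly_mul (hα : 0 < α) (hβ : 0 ≤ β) (ht : 0 < t)
    {m n : ℕ} {D E : ℝ[X]} (hDm : D.degree < m) (hEn : E.degree < n)
    (hD : HasCoeffDerivAt (fun s => orthoPoly α β s m) D t)
    (hE : HasCoeffDerivAt (fun s => orthoPoly α β s n) E t) :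
    HasDerivAt (fun s => momentFunctional (weight α β s) (orthoPoly α β s m * orthoPoly α β s n))
      (momentFunctional (weight α β t) (D * orthoPoly α β t n + orthoPoly α β t m * E) -
        momentFunctional (fun x => weight α β t x / x)
          (orthoPoly α β t m * orthoPoly α β t n)) t := by
  refine hasDerivAt_momentFunctional_weight_family hα hβ ht
    (fun s => natDegree_orthoPoly_mul_le α β s m n) ?_ (hD.mul hE)
  refine (natDegree_add_le _ _).trans (max_le ?_ ?_)
  all_goals
    refine natDegree_mul_le.trans (add_le_add ?_ ?_)
  exacts [natDegree_le_of_degree_le hDm.le, (natDegree_orthoPoly α β t n).le,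
    (natDegree_orthoPoly α β t m).le, natDegree_le_of_degree_le hEn.le]

end Parameter

section Evolution

/-- The coefficient of `x ^ (n - 1)` in `P_n`. -/
def pFun (n : ℕ) (α β t : ℝ) : ℝ :=
  (X * orthoPoly α β t n).coeff n

/-- `S_n(t) = (t / h_n) ∫₀¹ P_n(x)² w(x) / x dx`, encoded as `R_n(t) - (2n + 1 + α + β)`. -/
def SFun (n : ℕ) (α β t : ℝ) : ℝ :=
  RFun n α β t - (2 * n + 1 + α + β)

/-- The function `r*_n R_n - r_n S_n`, which evolves autonomously together with `S_n`. It is encoded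
through `R_n = S_n + 2n + 1 + α + β` and `r*_n - r_n = p_n`, which eliminate `r_n`. -/
def GFun (n : ℕ) (α β t : ℝ) : ℝ :=
  (2 * n + 1 + α + β) * rStar n α β t + pFun n α β t * SFun n α β t

variable {α β t : ℝ} (hα : 0 < α) (hβ : 0 < β)

theorem SFun_eq_S (ht : 0 ≤ t) (n : ℕ) : SFun n α β t = (pearsonSystem hα hβ ht).S n := by
  rw [SFun, RFun_eq_R hα hβ ht]
  exact sub_eq_of_eq_add (PearsonSystem.R_eq_S_add _ n)

theorem GFun_succ_eq_G (ht : 0 ≤ t) (n : ℕ) :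
    GFun (n + 1) α β t = (pearsonSystem hα hβ ht).G n := by
  rw [GFun, rStar_eq_rStar hα hβ ht, SFun_eq_S hα hβ ht, PearsonSystem.G_eq]
  push_cast
  change _ + (pearsonSystem hα hβ ht).p (n + 1) * _ = (2 * n + 3 + α + β) * _ + _
  ring

include hα hβ

theorem SFun_eq_pFun (ht : 0 ≤ t) (n : ℕ) : SFun n α β t = (2 * n + α + β) * pFun n α β t -
    (2 * (n + 1) + α + β) * pFun (n + 1) α β t + t - (2 * n + 1 + α) := by
  rw [SFun_eq_S hα hβ ht]
  exact PearsonSystem.S_eq_p _ n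

theorem SFun_pos (ht : 0 < t) (n : ℕ) : 0 < SFun n α β t := by
  have hL₁ : 0 < (pearsonSystem hα hβ ht.le).L₁ (orthoPoly α β t n * orthoPoly α β t n) :=
    momentFunctional_mul_self_pos (intervalIntegrable_weight_div hα hβ.le ht.le)
      (fun _ hx => div_pos (weight_pos α β t hx) hx.1)
      (monic_orthoPoly_and_natDegree_eq α β t n).1.ne_zero
  rw [SFun_eq_S hα hβ ht.le, PearsonSystem.S, ← normSq_eq_h]
  exact div_pos (mul_pos ht hL₁) (normSq_pos hα.le hβ.le ht.le n)

theorem RFun_pos (ht : 0 < t) (n : ℕ) : 0 < RFun n α β t := by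
  rw [← sub_add_cancel (RFun n α β t) (2 * n + 1 + α + β)]
  exact add_pos (SFun_pos hα hβ ht n) (by positivity)

theorem SFun_zero (n : ℕ) : SFun n α β 0 = 0 := by
  rw [SFun_eq_S hα hβ le_rfl, PearsonSystem.S]
  exact div_eq_zero_iff.2 (Or.inl (zero_mul _))

theorem continuousOn_SFun (n : ℕ) : ContinuousOn (SFun n α β) (Ici 0) := by
  have hp (m : ℕ) : ContinuousOn (pFun m α β) (Ici 0) := by
    rw [← closure_Ioi]
    exact (diffContOnCl_coeff_mul (fun _ => diffContOnCl_const)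
      (diffContOnCl_coeff_orthoPoly hα hβ.le m) m).continuousOn
  refine ContinuousOn.congr ?_ fun s hs => SFun_eq_pFun hα hβ hs n
  have := hp n
  have := hp (n + 1)
  fun_prop

theorem tendsto_SFun_zero (n : ℕ) : Tendsto (SFun n α β) (𝓝[>] 0) (𝓝 0) := by
  have h := (continuousOn_SFun hα hβ n 0 self_mem_Ici).mono_left
    (nhdsWithin_mono _ Ioi_subset_Ici_self)
  rwa [SFun_zero hα hβ] at h

theorem hasDerivAt_normSq (ht : 0 < t) (n : ℕ) :
    HasDerivAt (normSq n α β) (-(SFun n α β t * normSq n α β t) / t) t := by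
  obtain ⟨D, hDn, hD⟩ := exists_hasCoeffDerivAt_orthoPoly hα hβ.le ht n
  have hP := isMonicOrthogonal_orthoPoly hα.le hβ.le ht.le
  have key := hasDerivAt_momentFunctional_orthoPoly_mul hα hβ.le ht hDn hDn hD hD
  rw [map_add, mul_comm D, hP.map_mul_of_degree_lt hDn] at key
  refine (key.congr_deriv ?_).congr_of_eventuallyEq ?_
  · have hS : (pearsonSystem hα hβ ht.le).S n * (pearsonSystem hα hβ ht.le).h n =
      t * momentFunctional (fun x => weight α β t x / x) (orthoPoly α β t n * orthoPoly α β t n) :=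
      PearsonSystem.S_mul_h _ n
    rw [SFun_eq_S hα hβ ht.le, normSq_eq_h hα hβ ht.le, hS]
    field_simp
    ring
  · filter_upwards [Ioi_mem_nhds ht] with s hs using normSq_eq hα.le hβ.le (le_of_lt hs) n

theorem hasDerivAt_pFun_succ (ht : 0 < t) (n : ℕ) :
    HasDerivAt (pFun (n + 1) α β) (rStar (n + 1) α β t / t) t := by
  obtain ⟨D, hDn, hD⟩ := exists_hasCoeffDerivAt_orthoPoly hα hβ.le ht (n + 1)
  obtain ⟨E, hEn, hE⟩ := exists_hasCoeffDerivAt_orthoPoly hα hβ.le ht n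
  have hP := isMonicOrthogonal_orthoPoly hα.le hβ.le ht.le
  have hzero := hasDerivAt_momentFunctional_orthoPoly_mul hα hβ.le ht hDn hEn hD hE
  have key := hzero.unique <| (hasDerivAt_const t (0 : ℝ)).congr_of_eventuallyEq <| by
    filter_upwards [Ioi_mem_nhds ht] with s hs using
      (isMonicOrthogonal_orthoPoly hα.le hβ.le (le_of_lt hs)).orthogonal n.lt_succ_self
  rw [map_add, mul_comm D, hP.map_mul (natDegree_le_of_degree_lt_succ hDn),
    hP.map_mul_of_degree_lt (hEn.trans (by exact_mod_cast n.lt_succ_self)), add_zero,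
    ← normSq_eq hα.le hβ.le ht.le] at key
  have hρ : (pearsonSystem hα hβ ht.le).rStar n * (pearsonSystem hα hβ ht.le).h n =
      t * momentFunctional (fun x => weight α β t x / x)
        (orthoPoly α β t (n + 1) * orthoPoly α β t n) := PearsonSystem.rStar_mul_h _ n
  rw [← rStar_eq_rStar, ← normSq_eq_h] at hρ
  have h : rStar (n + 1) α β t / t = D.coeff n := by
    refine mul_right_cancel₀ (normSq_pos hα.le hβ.le ht.le n).ne' ?_
    field_simp
    linear_combination hρ - t * key
  rw [h]
  exact (hD n).congr_of_eventuallyEq (.of_forall fun _ => coeff_X_mul _ _)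

theorem hasDerivAt_SFun_succ (ht : 0 < t) (n : ℕ) :
    HasDerivAt (SFun (n + 1) α β) ((2 * GFun (n + 1) α β t + SFun (n + 1) α β t *
      (RFun (n + 1) α β t - β) - t * RFun (n + 1) α β t) / t) t := by
  have hriccati : (2 * n + 2 + α + β) * (pearsonSystem hα hβ ht.le).rStar n -
    (2 * n + 4 + α + β) * (pearsonSystem hα hβ ht.le).rStar (n + 1) + t = _ :=
    (pearsonSystem hα hβ ht.le).riccati n
  rw [GFun_succ_eq_G hα hβ ht.le, SFun_eq_S hα hβ ht.le, RFun_eq_R hα hβ ht.le]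
  have hderiv := ((((hasDerivAt_pFun_succ hα hβ ht n).const_mul (2 * ((n + 1 : ℕ) : ℝ) + α + β)).sub
    ((hasDerivAt_pFun_succ hα hβ ht (n + 1)).const_mul
      (2 * (((n + 1 : ℕ) : ℝ) + 1) + α + β))).add (hasDerivAt_id t)).sub_const
        (2 * ((n + 1 : ℕ) : ℝ) + 1 + α)
  refine (hderiv.congr_deriv ?_).congr_of_eventuallyEq ?_
  · rw [rStar_eq_rStar hα hβ ht.le, rStar_eq_rStar hα hβ ht.le]
    refine Eq.trans ?_ (congrArg (· / t) hriccati)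
    push_cast
    field_simp
    ring
  · filter_upwards [Ioi_mem_nhds ht] with s hs using SFun_eq_pFun hα hβ (le_of_lt hs) (n + 1)

theorem mul_normSq_div_eq (ht : 0 ≤ t) (n : ℕ) :
    (2 * n + 3 + α + β) * (2 * n + 1 + α + β) * (normSq (n + 1) α β t / normSq n α β t) =
      pFun (n + 1) α β t ^ 2 - (t + β) * pFun (n + 1) α β t +
        (2 * n + 2 + α + β) * rStar (n + 1) α β t - (n + 1) * t := by
  rw [normSq_eq_h hα hβ ht, normSq_eq_h hα hβ ht, rStar_eq_rStar hα hβ ht]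
  exact (pearsonSystem hα hβ ht).mul_b_eq n

theorem hasDerivAt_normSq_div (ht : 0 < t) (n : ℕ) :
    HasDerivAt (fun s => normSq (n + 1) α β s / normSq n α β s)
      (normSq (n + 1) α β t / normSq n α β t * (SFun n α β t - SFun (n + 1) α β t) / t) t := by
  have h₀ := (normSq_pos hα.le hβ.le ht.le n).ne'
  refine ((hasDerivAt_normSq hα hβ ht (n + 1)).div (hasDerivAt_normSq hα hβ ht n) h₀).congr_deriv ?_
  field_simp
  ring

theorem exists_hasDerivAt_rStar_succ (ht : 0 < t) (n : ℕ) :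
    ∃ δ, HasDerivAt (rStar (n + 1) α β) (δ / t) t ∧
      (2 * pFun (n + 1) α β t - (t + β)) * rStar (n + 1) α β t - t * pFun (n + 1) α β t +
        (2 * n + 2 + α + β) * δ - (n + 1) * t =
      (2 * n + 3 + α + β) * (2 * n + 1 + α + β) *
        (normSq (n + 1) α β t / normSq n α β t * (SFun n α β t - SFun (n + 1) α β t)) := by
  have hν : 2 * (n : ℝ) + 2 + α + β ≠ 0 := by positivity
  have hp := hasDerivAt_pFun_succ hα hβ ht n
  have hderiv := ((((hasDerivAt_normSq_div hα hβ ht n).const_mul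
    ((2 * n + 3 + α + β) * (2 * n + 1 + α + β))).sub (hp.pow 2)).add
      (((hasDerivAt_id t).add_const β).mul hp)).add ((hasDerivAt_id t).const_mul ((n : ℝ) + 1))
  have h := (hderiv.div_const (2 * (n : ℝ) + 2 + α + β)).congr_of_eventuallyEq
      (f₁ := rStar (n + 1) α β) <| by
    filter_upwards [Ioi_mem_nhds ht] with s hs
    refine eq_div_of_mul_eq hν ?_
    simp only [Pi.add_apply, Pi.sub_apply, Pi.mul_apply, Pi.pow_apply, id]
    linear_combination -mul_normSq_div_eq hα hβ (le_of_lt hs) n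
  refine ⟨t * deriv (rStar (n + 1) α β) t, ?_, ?_⟩
  · rw [mul_div_cancel_left₀ _ ht.ne']
    exact h.differentiableAt.hasDerivAt
  · rw [h.deriv]
    simp only [id]
    field_simp
    ring

theorem GFun_quadratic (ht : 0 ≤ t) (n : ℕ) : GFun (n + 1) α β t ^ 2 -
    t * RFun (n + 1) α β t * GFun (n + 1) α β t - β * SFun (n + 1) α β t * GFun (n + 1) α β t +
    (2 * n + 2 + α + β) * rStar (n + 1) α β t * RFun (n + 1) α β t * SFun (n + 1) α β t -
    (n + 1) * t * RFun (n + 1) α β t * SFun (n + 1) α β t = 0 := by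
  rw [GFun_succ_eq_G hα hβ ht, SFun_eq_S hα hβ ht, RFun_eq_R hα hβ ht, rStar_eq_rStar hα hβ ht]
  exact (pearsonSystem hα hβ ht).G_quadratic n

theorem hasDerivAt_GFun_succ (ht : 0 < t) (n : ℕ) :
    HasDerivAt (GFun (n + 1) α β)
      ((GFun (n + 1) α β t ^ 2 * (1 / RFun (n + 1) α β t + 2 / SFun (n + 1) α β t) +
        GFun (n + 1) α β t * (RFun (n + 1) α β t - β -
          β * SFun (n + 1) α β t / RFun (n + 1) α β t -
          2 * t * RFun (n + 1) α β t / SFun (n + 1) α β t) -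
        (n + 1) * t * RFun (n + 1) α β t) / t) t := by
  obtain ⟨δ, hρ, hδ⟩ := exists_hasDerivAt_rStar_succ hα hβ ht n
  have hS := (SFun_pos hα hβ ht (n + 1)).ne'
  have hR := (RFun_pos hα hβ ht (n + 1)).ne'
  have hderiv := (hρ.const_mul (2 * ((n + 1 : ℕ) : ℝ) + 1 + α + β)).add
    ((hasDerivAt_pFun_succ hα hβ ht n).mul (hasDerivAt_SFun_succ hα hβ ht n))
  refine hderiv.congr_deriv ?_
  rw [normSq_eq_h hα hβ ht.le, normSq_eq_h hα hβ ht.le, SFun_eq_S hα hβ ht.le n] at hδ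
  rw [GFun_succ_eq_G hα hβ ht.le]
  rw [SFun_eq_S hα hβ ht.le] at hS hδ ⊢
  rw [RFun_eq_R hα hβ ht.le] at hR ⊢
  rw [rStar_eq_rStar hα hβ ht.le] at hδ ⊢
  have hν : 2 * (n : ℝ) + 2 + α + β ≠ 0 := by positivity
  have hevol : (2 * n + 3 + α + β) * δ + _ + pFun (n + 1) α β t * (_ + _ * (_ - β) - t * _) = _ :=
    (pearsonSystem hα hβ ht.le).G_evolution n hR hS hν hδ
  refine Eq.trans ?_ (congrArg (· / t) hevol)
  push_cast
  ring

end Evolution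

section HankelDeterminant

variable {α β t : ℝ} (hα : 0 < α) (hβ : 0 < β)

include hα hβ

theorem continuousOn_hankelDet (n : ℕ) : ContinuousOn (hankelDet n α β) (Ici 0) := by
  refine ContinuousOn.congr (continuousOn_finsetProd (Finset.range n) fun j _ => ?_)
    fun _ hs => hankelDet_eq_prod hα.le hβ.le hs n
  rw [← closure_Ioi]
  exact (diffContOnCl_normSq_of_coeff hα hβ.le
    (diffContOnCl_coeff_orthoPoly hα hβ.le j)).continuousOn

theorem differentiableAt_hankelDet (ht : 0 < t) (n : ℕ) :
    DifferentiableAt ℝ (hankelDet n α β) t := by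
  have h : DifferentiableAt ℝ (fun s => ∏ j ∈ Finset.range n, normSq j α β s) t :=
    .fun_finsetProd fun j _ => (hasDerivAt_normSq hα hβ ht j).differentiableAt
  refine h.congr_of_eventuallyEq ?_
  filter_upwards [Ioi_mem_nhds ht] with s hs using hankelDet_eq_prod hα.le hβ.le (le_of_lt hs) n

theorem hasDerivAt_log_hankelDet_div (ht : 0 < t) (n : ℕ) :
    HasDerivAt (fun s => Real.log (hankelDet n α β s / hankelDet n α β 0))
      (-(∑ j ∈ Finset.range n, SFun j α β t) / t) t := by
  have h : HasDerivAt (fun s => ∑ j ∈ Finset.range n, Real.log (normSq j α β s) -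
      Real.log (hankelDet n α β 0)) (-(∑ j ∈ Finset.range n, SFun j α β t) / t) t := by
    rw [← Finset.sum_neg_distrib, Finset.sum_div]
    refine (HasDerivAt.fun_sum fun j _ => ?_).sub_const _
    have hj := (normSq_pos hα.le hβ.le ht.le j).ne'
    exact ((hasDerivAt_normSq hα hβ ht j).log hj).congr_deriv (by field_simp)
  refine h.congr_of_eventuallyEq ?_
  filter_upwards [Ioi_mem_nhds ht] with s (hs : 0 < s)
  rw [Real.log_div (hankelDet_pos hα.le hβ.le hs.le n).ne'
    (hankelDet_pos hα.le hβ.le le_rfl n).ne', hankelDet_eq_prod hα.le hβ.le hs.le,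
    Real.log_prod fun j _ => (normSq_pos hα.le hβ.le hs.le j).ne']

theorem HFun_eq_neg_sum (ht : 0 < t) (n : ℕ) :
    HFun n α β t = -∑ j ∈ Finset.range n, SFun j α β t := by
  rw [HFun, (hasDerivAt_log_hankelDet_div hα hβ ht n).deriv, mul_div_cancel₀ _ ht.ne']

theorem HFun_eq_pFun (ht : 0 < t) (n : ℕ) :
    HFun n α β t = (2 * n + α + β) * pFun n α β t + n * (n + α - t) := by
  rw [HFun_eq_neg_sum hα hβ ht, Finset.sum_congr rfl fun j _ => SFun_eq_S hα hβ ht.le j,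
    PearsonSystem.sum_S, neg_neg]
  rfl

theorem tendsto_HFun_zero (n : ℕ) : Tendsto (HFun n α β) (𝓝[>] 0) (𝓝 0) := by
  have h : Tendsto (fun t => -∑ j ∈ Finset.range n, SFun j α β t) (𝓝[>] 0)
      (𝓝 (-∑ j ∈ Finset.range n, 0)) :=
    (tendsto_finsetSum _ fun j _ => tendsto_SFun_zero hα hβ j).neg
  rw [Finset.sum_const_zero, neg_zero] at h
  refine h.congr' ?_
  filter_upwards [self_mem_nhdsWithin] with t ht using (HFun_eq_neg_sum hα hβ ht n).symm

theorem hankelDet_eq_mul_exp (ht : 0 < t) (n : ℕ) :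
    IntervalIntegrable (fun s => HFun n α β s / s) volume 0 t ∧
      hankelDet n α β t = hankelDet n α β 0 * Real.exp (∫ s in (0 : ℝ)..t, HFun n α β s / s) := by
  have h₀ := hankelDet_pos hα.le hβ.le le_rfl n
  have hcont : ContinuousOn (fun s => Real.log (hankelDet n α β s / hankelDet n α β 0))
      (Icc 0 t) :=
    (((continuousOn_hankelDet hα hβ n).mono Icc_subset_Ici_self).div_const _).log
      fun s hs => (div_pos (hankelDet_pos hα.le hβ.le hs.1 n) h₀).ne'
  have hderiv : ∀ s ∈ Ioo 0 t, HasDerivAt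
      (fun s => Real.log (hankelDet n α β s / hankelDet n α β 0)) (HFun n α β s / s) s := by
    intro s hs
    rw [HFun_eq_neg_sum hα hβ hs.1]
    exact hasDerivAt_log_hankelDet_div hα hβ hs.1 n
  have hint : IntervalIntegrable (fun s => HFun n α β s / s) volume 0 t := by
    rw [intervalIntegrable_iff_integrableOn_Ioc_of_le ht.le]
    refine integrable_neg_iff.1 <| intervalIntegral.integrableOn_deriv_of_nonneg hcont.neg
      (fun s hs => (hderiv s hs).neg) fun s hs => ?_
    rw [Pi.neg_apply, HFun_eq_neg_sum hα hβ hs.1, neg_div, neg_neg]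
    exact div_nonneg (Finset.sum_nonneg fun j _ => (SFun_pos hα hβ hs.1 j).le) hs.1.le
  refine ⟨hint, ?_⟩
  rw [intervalIntegral.integral_eq_sub_of_hasDerivAt_of_le ht.le hcont hderiv hint,
    div_self h₀.ne', Real.log_one, sub_zero,
    Real.exp_log (div_pos (hankelDet_pos hα.le hβ.le ht.le n) h₀), mul_div_cancel₀ _ h₀.ne']

end HankelDeterminant

section Painleve

theorem RFun_eq_SFun_add (n : ℕ) (α β t : ℝ) :
    RFun n α β t = SFun n α β t + (2 * n + 1 + α + β) :=
  (sub_add_cancel _ _).symm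

theorem yFun_eq_SFun_add_div (n : ℕ) (α β t : ℝ) :
    yFun n α β t = (SFun n α β t + (2 * n + 1 + α + β)) / (2 * n + 1 + α + β) := by
  rw [yFun, RFun_eq_SFun_add]

variable {α β t : ℝ} (hα : 0 < α) (hβ : 0 < β)

include hα hβ

theorem isPlanarFlow_SFun_GFun (n : ℕ) :
    IsPlanarFlow (n + 1 : ℕ) (2 * (n + 1 : ℕ) + 1 + α + β) β
      (SFun (n + 1) α β) (GFun (n + 1) α β) where
  hasDerivAt_fst ht := by
    simpa only [RFun_eq_SFun_add, velocityS] using hasDerivAt_SFun_succ hα hβ ht n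
  hasDerivAt_snd ht := by
    simpa only [RFun_eq_SFun_add, Nat.cast_succ, velocityG] using hasDerivAt_GFun_succ hα hβ ht n

theorem solvesPV_yFun (n : ℕ) :
    SolvesPV ((2 * (n + 1 : ℕ) + 1 + α + β) ^ 2 / 2) (-β ^ 2 / 2) α (-1 / 2)
      (yFun (n + 1) α β) := by
  have h := (isPlanarFlow_SFun_GFun hα hβ n).solvesPV
    (fun t ht => SFun_pos hα hβ ht (n + 1)) (by positivity)
  rw [← funext (yFun_eq_SFun_add_div (n + 1) α β)] at h
  convert h using 1
  ring

theorem deriv_yFun (ht : 0 < t) (n : ℕ) : deriv (yFun (n + 1) α β) t =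
    velocityS (2 * (n + 1 : ℕ) + 1 + α + β) β t (SFun (n + 1) α β t) (GFun (n + 1) α β t) /
      (2 * (n + 1 : ℕ) + 1 + α + β) / t := by
  rw [funext (yFun_eq_SFun_add_div (n + 1) α β)]
  exact ((isPlanarFlow_SFun_GFun hα hβ n).hasDerivAt_div ht).deriv

theorem HFun_eq_HExpr (ht : 0 < t) (n : ℕ) :
    HFun (n + 1) α β t =
      HExpr (n + 1) α β t (yFun (n + 1) α β t) (deriv (yFun (n + 1) α β) t) := by
  have hR := (RFun_pos hα hβ ht (n + 1)).ne'
  have hquad := GFun_quadratic hα hβ ht.le n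
  rw [RFun_eq_SFun_add] at hR hquad
  rw [HFun_eq_pFun hα hβ ht, deriv_yFun hα hβ ht, yFun_eq_SFun_add_div]
  refine (HExpr_eq_of_quadratic (G := GFun (n + 1) α β t) (ρ := rStar (n + 1) α β t) ht.ne'
    (SFun_pos hα hβ ht (n + 1)).ne' hR rfl (by positivity) rfl ?_).symm
  push_cast at hquad ⊢
  linear_combination hquad

theorem rStar_eq_rStarExpr (ht : 0 < t) (n : ℕ) :
    rStar (n + 1) α β t =
      rStarExpr (n + 1) α β t (yFun (n + 1) α β t) (deriv (yFun (n + 1) α β) t) := by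
  have hH := (HFun_eq_HExpr hα hβ ht n).symm.trans (HFun_eq_pFun hα hβ ht (n + 1))
  rw [deriv_yFun hα hβ ht, yFun_eq_SFun_add_div] at *
  exact (rStarExpr_eq_of_HExpr_eq ht.ne' rfl (by positivity) (by positivity) rfl hH).symm

theorem yFun_zero (n : ℕ) : yFun n α β 0 = 1 := by
  rw [yFun_eq_SFun_add_div, SFun_zero hα hβ, zero_add, div_self (by positivity)]

theorem tendsto_yFun_one (n : ℕ) : Tendsto (yFun n α β) (𝓝[>] 0) (𝓝 1) := by
  have h := ((tendsto_SFun_zero hα hβ n).add_const (2 * n + 1 + α + β)).div_const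
    (2 * n + 1 + α + β)
  rwa [zero_add, div_self (by positivity), ← funext (yFun_eq_SFun_add_div n α β)] at h

theorem hankelDet_eq_mul_exp_HExpr (ht : 0 < t) (n : ℕ) :
    IntervalIntegrable (fun s => HExpr (n + 1) α β s (yFun (n + 1) α β s)
      (deriv (yFun (n + 1) α β) s) / s) volume 0 t ∧
    hankelDet (n + 1) α β t = hankelDet (n + 1) α β 0 *
      Real.exp (∫ s in (0 : ℝ)..t, HExpr (n + 1) α β s (yFun (n + 1) α β s)
        (deriv (yFun (n + 1) α β) s) / s) := by
  obtain ⟨hint, hD⟩ := hankelDet_eq_mul_exp hα hβ ht (n + 1)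
  have heq : EqOn (fun s => HFun (n + 1) α β s / s) (fun s => HExpr (n + 1) α β s
      (yFun (n + 1) α β s) (deriv (yFun (n + 1) α β) s) / s) (uIoc 0 t) := by
    intro s hs
    rw [uIoc_of_le ht.le] at hs
    simp only [HFun_eq_HExpr hα hβ hs.1]
  refine ⟨hint.congr heq, ?_⟩
  rw [hD, intervalIntegral.integral_congr_ae (.of_forall fun s hs => heq hs)]

end Painleve

end

end PollaczekJacobi

theorem lemma1 (n : ℕ) (hn : 1 ≤ n) (α β : ℝ) (hα : 0 < α) (hβ : 0 < β) :
    (∀ t : ℝ, 0 ≤ t → 0 < hankelDet n α β t) ∧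
    (∀ t : ℝ, 0 < t → DifferentiableAt ℝ (hankelDet n α β) t) ∧
    SolvesPV ((2 * n + 1 + α + β) ^ 2 / 2) (-β ^ 2 / 2) α (-1 / 2) (yFun n α β) ∧
    yFun n α β 0 = 1 ∧ Tendsto (yFun n α β) (𝓝[>] 0) (𝓝 1) ∧
    (∀ t : ℝ, 0 < t →
      HFun n α β t = HExpr n α β t (yFun n α β t) (deriv (yFun n α β) t)) ∧
    HFun n α β 0 = 0 ∧ Tendsto (HFun n α β) (𝓝[>] 0) (𝓝 0) ∧
    (∀ t : ℝ, 0 < t →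
      rStar n α β t = rStarExpr n α β t (yFun n α β t) (deriv (yFun n α β) t)) ∧
    (∀ t : ℝ, 0 < t →
      IntervalIntegrable (fun s => HExpr n α β s (yFun n α β s) (deriv (yFun n α β) s) / s)
        MeasureTheory.volume 0 t ∧
      hankelDet n α β t = hankelDet n α β 0 *
        Real.exp (∫ s in (0 : ℝ)..t,
          HExpr n α β s (yFun n α β s) (deriv (yFun n α β) s) / s)) := by
  obtain ⟨m, rfl⟩ : ∃ m, n = m + 1 := ⟨n - 1, by omega⟩
  exact ⟨fun t ht => hankelDet_pos hα.le hβ.le ht _,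
    fun t ht => differentiableAt_hankelDet hα hβ ht _,
    solvesPV_yFun hα hβ m, yFun_zero hα hβ _, tendsto_yFun_one hα hβ _,
    fun t ht => HFun_eq_HExpr hα hβ ht m, by simp [HFun], tendsto_HFun_zero hα hβ _,
    fun t ht => rStar_eq_rStarExpr hα hβ ht m, fun t ht => hankelDet_eq_mul_exp_HExpr hα hβ ht m⟩
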